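/- An instance consists of three disjoint sets of agents $A,B,C$ with $|A|=|B|=|C|=n$, where each $a\in A$ has a strict preference list over $B$, each $b\in B$ a strict preference list over $C$, and each $c\in C$ a strict preference list over $A$; all lists are complete, i.e. they contain all $n$ agents of the respective class. A matching $M$ is a set of triples in $A\times B\times C$ in which each agent occurs at most once; for $(a,b,c)\in M$ write $M(a)=b$, $M(b)=c$, and every agent considers being unmatched worse than any partner. A matching $M'$ is $A\cup B$-more popular than $M$ if more agents of $A\cup B$ prefer their partner in $M'$ to that in $M$ than vice versa, and $M$ is $A\cup B$-popular if no matching is $A\cup B$-more popular than $M$. In the house allocation instance $(A,B)$ the agents of $A$ are applicants who rank the houses $B$; its matchings are sets of pairs in $A\times B$ in which each applicant and each house occurs at most once, and such a matching is popular if no other matching wins the corresponding vote among the applicants $A$. The house allocation instance $(B,C)$ is defined analogously. The following hold. 1. There is an algorithm that, given an instance and a matching $M$ of it, decides in linear time whether $M$ is $A\cup B$-popular. 2. There is an algorithm that, given an instance, finds in linear time an $A\cup B$-popular matching or reports that none exists. 3. A matching $M$ is $A\cup B$-popular if and only if $\{(a,M(a)) : a\in A \text{ matched}\}$ is popular in $(A,B)$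 and $\{(b,M(b)) : b\in B \text{ matched}\}$ is popular in $(B,C)$; and an $A\cup B$-popular matching exists if and only if both $(A,B)$ and $(B,C)$ admit a popular matching. Here linear time means $O(N)$ steps on a random access machine with addition and subtraction, all of whose words have value $O(N)$, where $N$ is the length of the input in words: the number $n$, all preference lists with their lengths and, in part 1, the triples of $M$ with their number. -/

import Mathlib

/-! Random access machine -/

namespace RAM

/-- A configuration: registers and a random access memory, both holding natural numbers. -/
structure State where
  reg : ℕ → ℕ
  mem : ℕ → ℕ

/-- Elementary instructions; the arguments `r s t` are register numbers. -/
inductive Instr where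
  /-- `reg r := k` -/
  | const (r k : ℕ)
  /-- `reg r := reg s` -/
  | copy (r s : ℕ)
  /-- `reg r := reg s + reg t` -/
  | add (r s t : ℕ)
  /-- `reg r := reg s - reg t` (truncated at zero) -/
  | sub (r s t : ℕ)
  /-- `reg r := mem (reg s)` -/
  | load (r s : ℕ)
  /-- `mem (reg r) := reg s` -/
  | store (r s : ℕ)

/-- The word that an instruction writes. -/
def Instr.word : Instr → State → ℕ
  | const _ k, _ => k
  | copy _ s, σ => σ.reg s
  | add _ s t, σ => σ.reg s + σ.reg t
  | sub _ s t, σ => σ.reg s - σ.reg t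
  | load _ s, σ => σ.mem (σ.reg s)
  | store _ s, σ => σ.reg s

/-- The effect of an instruction. -/
def Instr.exec (i : Instr) (σ : State) : State :=
  match i with
  | const r _ => { σ with reg := Function.update σ.reg r (i.word σ) }
  | copy r _ => { σ with reg := Function.update σ.reg r (i.word σ) }
  | add r _ _ => { σ with reg := Function.update σ.reg r (i.word σ) }
  | sub r _ _ => { σ with reg := Function.update σ.reg r (i.word σ) }
  | load r _ => { σ with reg := Function.update σ.reg r (i.word σ) }
  | store r _ => { σ with mem := Function.update σ.mem (σ.reg r) (i.word σ) }

/-- Tests comparing two registers. -/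
inductive Test where
  | lt (r s : ℕ)
  | eq (r s : ℕ)

def Test.Holds : Test → State → Prop
  | lt r s, σ => σ.reg r < σ.reg s
  | eq r s, σ => σ.reg r = σ.reg s

/-- Random access machine programs, in structured form. -/
inductive Prog where
  | skip
  | instr (i : Instr)
  | seq (p q : Prog)
  | ite (c : Test) (p q : Prog)
  | while (c : Test) (p : Prog)

/-- `Run W p σ k τ`: on a machine whose words hold the numbers `0, …, W`, the program `p`, started
in `σ`, halts in `τ` after exactly `k` steps. Every instruction and every evaluation of a test is one
step; a machine that would have to write a number exceeding `W` gets stuck. -/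
inductive Run (W : ℕ) : Prog → State → ℕ → State → Prop
  | skip (σ : State) : Run W .skip σ 1 σ
  | instr (i : Instr) (σ : State) (h : i.word σ ≤ W) : Run W (.instr i) σ 1 (i.exec σ)
  | seq {p q : Prog} {σ τ υ : State} {k l : ℕ} (hp : Run W p σ k τ) (hq : Run W q τ l υ) :
      Run W (.seq p q) σ (k + l) υ
  | iteTrue {c : Test} {p q : Prog} {σ τ : State} {k : ℕ} (hc : c.Holds σ) (hp : Run W p σ k τ) :
      Run W (.ite c p q) σ (k + 1) τ
  | iteFalse {c : Test} {p q : Prog} {σ τ : State} {k : ℕ} (hc : ¬ c.Holds σ)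
      (hq : Run W q σ k τ) : Run W (.ite c p q) σ (k + 1) τ
  | whileTrue {c : Test} {p : Prog} {σ τ υ : State} {k l : ℕ} (hc : c.Holds σ)
      (hp : Run W p σ k τ) (hw : Run W (.while c p) τ l υ) : Run W (.while c p) σ (k + l + 1) υ
  | whileFalse {c : Test} {p : Prog} {σ : State} (hc : ¬ c.Holds σ) : Run W (.while c p) σ 1 σ

/-- The machine is deterministic. -/
theorem Run.deterministic {W : ℕ} {p : Prog} {σ τ τ₁ : State} {k k₁ : ℕ} (h : Run W p σ k τ)
    (h₁ : Run W p σ k₁ τ₁) : k = k₁ ∧ τ = τ₁ := by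
  induction h generalizing k₁ τ₁ with
  | skip σ => cases h₁; exact ⟨rfl, rfl⟩
  | instr i σ h => cases h₁; exact ⟨rfl, rfl⟩
  | seq hp hq ihp ihq =>
    cases h₁ with
    | seq hp₁ hq₁ =>
      obtain ⟨rfl, rfl⟩ := ihp hp₁
      obtain ⟨rfl, rfl⟩ := ihq hq₁
      exact ⟨rfl, rfl⟩
  | iteTrue hc hp ih =>
    cases h₁ with
    | iteTrue _ hp₁ => obtain ⟨rfl, rfl⟩ := ih hp₁; exact ⟨rfl, rfl⟩
    | iteFalse hc₁ _ => exact absurd hc hc₁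
  | iteFalse hc hq ih =>
    cases h₁ with
    | iteTrue hc₁ _ => exact absurd hc₁ hc
    | iteFalse _ hq₁ => obtain ⟨rfl, rfl⟩ := ih hq₁; exact ⟨rfl, rfl⟩
  | whileTrue hc hp hw ihp ihw =>
    cases h₁ with
    | whileTrue _ hp₁ hw₁ =>
      obtain ⟨rfl, rfl⟩ := ihp hp₁
      obtain ⟨rfl, rfl⟩ := ihw hw₁
      exact ⟨rfl, rfl⟩
    | whileFalse hc₁ => exact absurd hc hc₁
  | whileFalse hc =>
    cases h₁ with
    | whileTrue hc₁ _ _ => exact absurd hc₁ hc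
    | whileFalse _ => exact ⟨rfl, rfl⟩

/-- Initially the memory holds the input, from address `0` on; all else is zero. -/
def init (input : List ℕ) : State where
  reg := fun _ => 0
  mem := fun i => input.getD i 0

/-- The program `p` halts on `input` after at most `K * (length of the input)` steps, using only
words of value at most `K * (length of the input)` (that is, words of logarithmic bit length), and
leaves `output` in the memory, from address `0` on. -/
def OutputsWithin (p : Prog) (K : ℕ) (input output : List ℕ) : Prop :=
  ∃ k ≤ K * input.length, ∃ τ : State, Run (K * input.length) p (init input) k τ ∧
    ∀ (i : ℕ) (h : i < output.length), τ.mem i = output[i]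

end RAM

/-! Preferences and votes -/

/-- The partner described by a set of candidates (with at most one element in all uses below);
`none` stands for being unmatched. -/
noncomputable def partnerOf {β : Type*} (s : Set β) : Option β :=
  open Classical in if h : s.Nonempty then some h.choose else none

/-- The position of an outcome in the preference list `l`, most preferred first, where being
unmatched is put at the very end of the list. -/
def position {β : Type*} [DecidableEq β] (l : List β) : Option β → ℕ
  | some y => l.idxOf y
  | none => l.length

/-- The vote of an agent with preference list `l` between outcome `o₁` and outcome `o₂`. -/
def vote {β : Type*} [DecidableEq β] (l : List β) (o₁ o₂ : Option β) : ℤ :=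
  if position l o₁ < position l o₂ then 1
  else if position l o₂ < position l o₁ then -1
  else 0

/-! House allocation -/

/-- A house allocation instance: applicants `X`, houses `Y`, and strict, possibly incomplete
preference lists of the applicants over the houses. -/
structure HouseAllocation (X Y : Type*) where
  pref : X → List Y
  nodup : ∀ x, (pref x).Nodup

namespace HouseAllocation

variable {X Y : Type*} [Fintype X] [DecidableEq Y]

structure IsMatching (H : HouseAllocation X Y) (N : Finset (X × Y)) : Prop where
  acceptable : ∀ e ∈ N, e.2 ∈ H.pref e.1
  applicant_unique : ∀ e ∈ N, ∀ f ∈ N, e.1 = f.1 → e = f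
  house_unique : ∀ e ∈ N, ∀ f ∈ N, e.2 = f.2 → e = f

/-- The house of applicant `x` under `N`. -/
noncomputable def houseOf (N : Finset (X × Y)) (x : X) : Option Y :=
  partnerOf {y | (x, y) ∈ N}

def MorePopular (H : HouseAllocation X Y) (N₁ N₂ : Finset (X × Y)) : Prop :=
  1 ≤ ∑ x, vote (H.pref x) (houseOf N₁ x) (houseOf N₂ x)

def IsPopular (H : HouseAllocation X Y) (N : Finset (X × Y)) : Prop :=
  H.IsMatching N ∧ ∀ N₁, H.IsMatching N₁ → ¬ H.MorePopular N₁ N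

end HouseAllocation

/-! Three-dimensional matching with cyclic preferences -/

/-- Three disjoint classes `A`, `B`, `C` of `n` agents each, every class being indexed by `Fin n`,
with cyclic preferences: `A` ranks `B`, `B` ranks `C`, and `C` ranks `A`. Each agent has a strict,
possibly incomplete preference list, most preferred agent first; the agents on the list are the
acceptable ones. -/
structure CyclicInstance (n : ℕ) where
  prefA : Fin n → List (Fin n)
  prefB : Fin n → List (Fin n)
  prefC : Fin n → List (Fin n)
  nodupA : ∀ a, (prefA a).Nodup
  nodupB : ∀ b, (prefB b).Nodup
  nodupC : ∀ c, (prefC c).Nodup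

/-- A triple `(a, b, c)` of agents `a ∈ A`, `b ∈ B`, `c ∈ C`. -/
abbrev Triple (n : ℕ) := Fin n × Fin n × Fin n

namespace CyclicInstance

variable {n : ℕ}

/-- Every agent ranks all agents of the next class. -/
structure Complete (I : CyclicInstance n) : Prop where
  completeA : ∀ a b, b ∈ I.prefA a
  completeB : ∀ b c, c ∈ I.prefB b
  completeC : ∀ c a, a ∈ I.prefC c

structure IsMatching (I : CyclicInstance n) (M : Finset (Triple n)) : Prop where
  acceptableA : ∀ t ∈ M, t.2.1 ∈ I.prefA t.1
  acceptableB : ∀ t ∈ M, t.2.2 ∈ I.prefB t.2.1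
  acceptableC : ∀ t ∈ M, t.1 ∈ I.prefC t.2.2
  uniqueA : ∀ t ∈ M, ∀ u ∈ M, t.1 = u.1 → t = u
  uniqueB : ∀ t ∈ M, ∀ u ∈ M, t.2.1 = u.2.1 → t = u
  uniqueC : ∀ t ∈ M, ∀ u ∈ M, t.2.2 = u.2.2 → t = u

/-- The partner `M(a) ∈ B` of `a ∈ A`. -/
noncomputable def partnerA (M : Finset (Triple n)) (a : Fin n) : Option (Fin n) :=
  partnerOf {b | ∃ c, (a, b, c) ∈ M}

/-- The partner `M(b) ∈ C` of `b ∈ B`. -/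
noncomputable def partnerB (M : Finset (Triple n)) (b : Fin n) : Option (Fin n) :=
  partnerOf {c | ∃ a, (a, b, c) ∈ M}

/-- `M₁` beats `M₂` in the election in which exactly the agents in `A ∪ B` vote. -/
def ABMorePopular (I : CyclicInstance n) (M₁ M₂ : Finset (Triple n)) : Prop :=
  1 ≤ (∑ a, vote (I.prefA a) (partnerA M₁ a) (partnerA M₂ a)) +
    (∑ b, vote (I.prefB b) (partnerB M₁ b) (partnerB M₂ b))

def IsABPopular (I : CyclicInstance n) (M : Finset (Triple n)) : Prop :=
  I.IsMatching M ∧ ∀ M₁, I.IsMatching M₁ → ¬ I.ABMorePopular M₁ M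

/-- The house allocation instance `(A, B)`. -/
def houseAB (I : CyclicInstance n) : HouseAllocation (Fin n) (Fin n) := ⟨I.prefA, I.nodupA⟩

/-- The house allocation instance `(B, C)`. -/
def houseBC (I : CyclicInstance n) : HouseAllocation (Fin n) (Fin n) := ⟨I.prefB, I.nodupB⟩

/-- The pairs `(a, M(a))`. -/
def pairsAB (M : Finset (Triple n)) : Finset (Fin n × Fin n) := M.image fun t => (t.1, t.2.1)

/-- The pairs `(b, M(b))`. -/
def pairsBC (M : Finset (Triple n)) : Finset (Fin n × Fin n) := M.image fun t => (t.2.1, t.2.2)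

/-- The preference lists of one agent class, each preceded by its length. -/
def encodeLists (pref : Fin n → List (Fin n)) : List ℕ :=
  (List.finRange n).flatMap fun x => (pref x).length :: (pref x).map fun y => (y : ℕ)

/-- An instance as a sequence of words: the number `n`, then all preference lists. -/
def encode (I : CyclicInstance n) : List ℕ :=
  n :: (encodeLists I.prefA ++ encodeLists I.prefB ++ encodeLists I.prefC)

end CyclicInstance

/-- A list of triples as a sequence of words: the number of triples, then the triples. -/
def encodeTriples {n : ℕ} (L : List (Triple n)) : List ℕ :=
  L.length :: L.flatMap fun t => [(t.1 : ℕ), (t.2.1 : ℕ), (t.2.2 : ℕ)]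

/-!
Agents of `A` and `B` vote about different parts of a three-dimensional matching: a matching of
`(A, B)` and one of `(B, C)`. All lists are complete and the classes have the same size, so every
matching of either instance extends to a bijection, which harms nobody as being unmatched is
worst, and any two bijections compose to a three-dimensional matching. Hence an election among
`A ∪ B` can be won if and only if one can be won in `(A, B)` or in `(B, C)`
(`CyclicInstance.isABPopular_iff`, `CyclicInstance.exists_isABPopular_iff`).

For a single house allocation instance, a popular matching is a bijection `σ`, and a bijection is
popular if and only if every house envied by somebody is the first choice of its holder
(`HouseAllocation.isPopular_graph_iff`). If not, promoting the envious applicant and the holder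
wins two votes and loses at most one; if so, everybody who improves evicts somebody who gets
worse. This criterion is decided by marking the houses held by an applicant with that first
choice, and running down each list as far as the assigned house (`RAM.wp_verify`).

Equivalently, `σ x` is the first choice of `x` or the best house on the list of `x` that is
nobody's first choice (`HouseAllocation.IsFirstSecond.envyFirst_iff`). So it remains to assign
houses to applicants with two options each. Applicants are inserted one at a time. From a house
one moves on to the other option of its occupant, and so on, until a free house is met; each house
on the way has a well-defined distance to the free one, so this takes fewer than `n` moves, and
the evictions along the walk can be carried out one after the other. If the walks from both
options of a new applicant fail, consider all houses from which the walk fails: both options of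
each of their occupants, and of the new applicant, are among them, so there are too few houses
(`TwoChoice.Assigns.not_exists_injective`). An insertion costs `O(n)` steps, which is affordable
since the input has more than `n ^ 2` words.

The programs are verified in a Hoare logic for total correctness in which time bounds are part of
the judgement (`RAM.WP`). All words written are at most a constant multiple of the length of the
input, as scratch memory lies directly behind the input and only sums and constants can produce
new large words.
-/

set_option linter.unusedSectionVars false

/-! ### Votes and house allocation with complete lists -/

theorem partnerOf_eq_some {β : Type*} {s : Set β} {y : β} (hy : y ∈ s) (h : ∀ z ∈ s, z = y) :
    partnerOf s = some y := by
  have hs : s.Nonempty := ⟨y, hy⟩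
  rw [partnerOf, dif_pos hs, h _ hs.choose_spec]

theorem partnerOf_eq_none {β : Type*} {s : Set β} (h : ∀ y, y ∉ s) : partnerOf s = none :=
  dif_neg fun ⟨y, hy⟩ => h y hy

section Vote

variable {β : Type*} [DecidableEq β] {l : List β} {o₁ o₂ o₁' o₂' : Option β}

theorem vote_mono (h₁ : position l o₁' ≤ position l o₁) (h₂ : position l o₂ ≤ position l o₂') :
    vote l o₁ o₂ ≤ vote l o₁' o₂' := by
  unfold vote
  split_ifs <;> omega

theorem vote_self (l : List β) (o : Option β) : vote l o o = 0 := by simp [vote]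

theorem vote_nonneg (h : position l o₁ ≤ position l o₂) : 0 ≤ vote l o₁ o₂ := by
  unfold vote
  split_ifs <;> omega

theorem vote_eq_one (h : position l o₁ < position l o₂) : vote l o₁ o₂ = 1 := by
  simp [vote, h]

theorem position_le_length (l : List β) (o : Option β) : position l o ≤ l.length := by
  cases o with
  | none => exact le_rfl
  | some y => exact List.idxOf_le_length

theorem neg_one_le_vote (l : List β) (o₁ o₂ : Option β) : -1 ≤ vote l o₁ o₂ := by
  unfold vote
  split_ifs <;> omega

end Vote

namespace HouseAllocation

variable {X Y : Type*} [Fintype X] [Fintype Y] [DecidableEq X] [DecidableEq Y]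
  {H : HouseAllocation X Y} {N : Finset (X × Y)} {σ τ : X ≃ Y}

/-- The perfect matching given by a bijection between applicants and houses. -/
def graph (σ : X ≃ Y) : Finset (X × Y) := Finset.univ.image fun x => (x, σ x)

theorem mem_graph {e : X × Y} : e ∈ graph σ ↔ σ e.1 = e.2 := by
  obtain ⟨x, y⟩ := e
  simp [graph]

theorem isMatching_graph (hH : ∀ x y, y ∈ H.pref x) (σ : X ≃ Y) : H.IsMatching (graph σ) where
  acceptable e _ := hH _ _
  applicant_unique e he f hf h := by
    rw [mem_graph] at he hf
    exact Prod.ext h (by rw [← he, ← hf, h])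
  house_unique e he f hf h := by
    rw [mem_graph] at he hf
    exact Prod.ext (σ.injective (by rw [he, hf, h])) h

theorem IsMatching.houseOf_eq_some (hN : H.IsMatching N) {x : X} {y : Y} (h : (x, y) ∈ N) :
    houseOf N x = some y :=
  partnerOf_eq_some h fun _ hz => congrArg Prod.snd (hN.applicant_unique _ hz _ h rfl)

theorem houseOf_eq_none {x : X} (h : ∀ y, (x, y) ∉ N) : houseOf N x = none :=
  partnerOf_eq_none h

theorem houseOf_graph (hH : ∀ x y, y ∈ H.pref x) (σ : X ≃ Y) (x : X) :
    houseOf (graph σ) x = some (σ x) :=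
  (isMatching_graph hH σ).houseOf_eq_some (mem_graph.2 rfl)

/-- With as many houses as applicants, every matching is part of a perfect one. -/
theorem IsMatching.exists_equiv (hN : H.IsMatching N)
    (hc : Fintype.card X = Fintype.card Y) : ∃ σ : X ≃ Y, N ⊆ graph σ := by
  classical
  let e₀ : X ≃ Y := Fintype.equivOfCardEq hc
  let f : X → Y := fun x => if h : ∃ y, (x, y) ∈ N then h.choose else e₀ x
  have hf : ∀ x, (∃ y, (x, y) ∈ N) → (x, f x) ∈ N := fun x h => by
    simp only [f, dif_pos h]
    exact h.choose_spec
  obtain ⟨g, hg⟩ := Set.MapsTo.exists_equiv_extend_of_card_eq (t := Finset.univ)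
    (by rw [hc, Finset.card_univ]) (s := {x | ∃ y, (x, y) ∈ N}) (f := f)
    (fun x _ => Finset.mem_coe.2 (Finset.mem_univ _))
    (fun x hx x' hx' h => congrArg Prod.fst (hN.house_unique _ (hf x hx) _ (hf x' hx') h))
  refine ⟨g.trans (Equiv.subtypeUnivEquiv Finset.mem_univ), fun e he => mem_graph.2 ?_⟩
  have h1 : ∃ y, (e.1, y) ∈ N := ⟨e.2, he⟩
  have h2 := hN.applicant_unique _ (hf e.1 h1) e he rfl
  change (g e.1 : Y) = e.2
  rw [hg _ h1, ← h2]

/-- Being assigned in a larger matching is no worse, since being unmatched comes last. -/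
theorem position_le_of_subset_graph (hN : H.IsMatching N) (h : N ⊆ graph σ) (x : X) :
    position (H.pref x) (some (σ x)) ≤ position (H.pref x) (houseOf N x) := by
  by_cases hx : ∃ y, (x, y) ∈ N
  · obtain ⟨y, hy⟩ := hx
    rw [hN.houseOf_eq_some hy, mem_graph.1 (h hy)]
  · rw [houseOf_eq_none (not_exists.1 hx)]
    exact position_le_length _ _

/-- A house that some applicant prefers to its own is the first choice of the applicant who
holds it. -/
def EnvyFirst (H : HouseAllocation X Y) (σ : X ≃ Y) : Prop :=
  ∀ x y, (H.pref x).idxOf y < (H.pref x).idxOf (σ x) → (H.pref (σ.symm y)).idxOf y = 0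

/-- If every envied house is the first choice of its holder, then each applicant who improves
under `τ` evicts one who gets worse. -/
theorem EnvyFirst.sum_vote_le (hσ : H.EnvyFirst σ) (hH : ∀ x y, y ∈ H.pref x) (τ : X ≃ Y) :
    ∑ x, vote (H.pref x) (some (τ x)) (some (σ x)) ≤ 0 := by
  -- `g` indicates the applicants who improve, and `π x` is the applicant evicted by `x`.
  let g : X → ℤ := fun x =>
    if (H.pref x).idxOf (τ x) < (H.pref x).idxOf (σ x) then 1 else 0
  let π : X ≃ X := τ.trans σ.symm
  have key : ∀ z, vote (H.pref z) (some (τ z)) (some (σ z)) ≤ g z - g (π.symm z) := by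
    intro z
    by_cases hz : (H.pref (π.symm z)).idxOf (τ (π.symm z)) <
        (H.pref (π.symm z)).idxOf (σ (π.symm z))
    -- `z` is evicted by somebody who envies it, so `z` holds its first choice and gets worse.
    · have h1 : τ (π.symm z) = σ z := by simp [π]
      have h2 := hσ _ _ hz
      rw [h1, Equiv.symm_apply_apply] at h2
      have h3 : τ z ≠ σ z := by
        intro h
        have h4 : π.symm z = z := τ.injective (h1.trans h.symm)
        rw [h4, h] at hz
        exact lt_irrefl _ hz
      have h5 : (H.pref z).idxOf (τ z) ≠ 0 := fun h =>
        h3 ((List.idxOf_inj (hH _ _)).1 (h.trans h2.symm))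
      have h6 : g z = 0 := if_neg (by omega)
      have h7 : g (π.symm z) = 1 := if_pos hz
      rw [h6, h7]
      simp only [vote, position]
      split_ifs <;> omega
    · have h7 : g (π.symm z) = 0 := if_neg hz
      rw [h7]
      simp only [vote, position, g]
      split_ifs <;> omega
  calc _ ≤ ∑ z, (g z - g (π.symm z)) := Finset.sum_le_sum fun z _ => key z
    _ = 0 := by rw [Finset.sum_sub_distrib, Equiv.sum_comp π.symm g, sub_self]

/-- The rotation in which `x` takes the house of `z`, and `z` takes the house of `u`; the two are
swapped if `u = x`, and otherwise `u` takes the house of `x`. -/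
theorem exists_rotate {x z u : X} (hxz : x ≠ z) (hzu : z ≠ u) (σ : X ≃ Y) :
    ∃ τ : X ≃ Y, τ x = σ z ∧ τ z = σ u ∧ ∀ a, a ≠ x → a ≠ z → a ≠ u → τ a = σ a := by
  by_cases hu : u = x
  · subst hu
    exact ⟨(Equiv.swap u z).trans σ, by simp, by simp, fun a h1 h2 _ => by
      simp [Equiv.swap_apply_of_ne_of_ne h1 h2]⟩
  · refine ⟨((Equiv.swap z u).trans (Equiv.swap x z)).trans σ, ?_, ?_, fun a h1 h2 h3 => ?_⟩
    · simp [Equiv.swap_apply_of_ne_of_ne hxz (Ne.symm hu)]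
    · simp [Equiv.swap_apply_of_ne_of_ne hu (Ne.symm hzu)]
    · simp [Equiv.swap_apply_of_ne_of_ne h2 h3, Equiv.swap_apply_of_ne_of_ne h1 h2]

/-- If `x` envies `z`, who is not assigned its first choice `w`, then promoting both of them and
giving the house of `x` to the holder of `w` wins the vote. -/
theorem exists_one_le_sum_vote_of_not_envyFirst (hH : ∀ x y, y ∈ H.pref x)
    (hσ : ¬ H.EnvyFirst σ) :
    ∃ τ : X ≃ Y, 1 ≤ ∑ x, vote (H.pref x) (some (τ x)) (some (σ x)) := by
  simp only [EnvyFirst, not_forall] at hσ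
  obtain ⟨x, y, hxy, hy⟩ := hσ
  obtain ⟨z, rfl⟩ := σ.surjective y
  rw [Equiv.symm_apply_apply] at hy
  have hpos : 0 < (H.pref z).length := List.length_pos_of_mem (hH z (σ z))
  obtain ⟨u, hu⟩ := σ.surjective ((H.pref z)[0])
  have hu0 : (H.pref z).idxOf (σ u) = 0 := by
    rw [hu]
    exact (H.nodup z).idxOf_getElem 0 hpos
  have hxz : x ≠ z := by rintro rfl; exact lt_irrefl _ hxy
  have hzu : z ≠ u := by rintro rfl; exact hy hu0
  obtain ⟨τ, hτx, hτz, hτ⟩ := exists_rotate hxz hzu σ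
  refine ⟨τ, ?_⟩
  -- The two promoted applicants gain a vote each, and at most `u` loses one; `u = x` is possible.
  have key : ∀ a, ((if a = x then 1 else 0) + (if a = z then 1 else 0) -
      (if a = u then 1 else 0) : ℤ) ≤ vote (H.pref a) (some (τ a)) (some (σ a)) := by
    intro a
    by_cases h1 : a = x
    · subst h1
      rw [vote_eq_one (by rw [hτx]; exact hxy)]
      split_ifs <;> omega
    by_cases h2 : a = z
    · subst h2
      rw [vote_eq_one (by rw [hτz]; change List.idxOf _ _ < List.idxOf _ _; omega)]
      split_ifs <;> omega
    by_cases h3 : a = u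
    · have := neg_one_le_vote (H.pref a) (some (τ a)) (some (σ a))
      rw [if_neg h1, if_neg h2, if_pos h3]
      omega
    · rw [hτ a h1 h2 h3, vote_self]
      simp [h1, h2, h3]
  refine le_trans ?_ (Finset.sum_le_sum fun a _ => key a)
  simp [Finset.sum_add_distrib, Finset.sum_sub_distrib]

/-- A perfect matching needs to be compared with perfect matchings only, since extending a matching
harms nobody. -/
theorem isPopular_graph_iff (hH : ∀ x y, y ∈ H.pref x) (hc : Fintype.card X = Fintype.card Y) :
    H.IsPopular (graph σ) ↔ H.EnvyFirst σ := by
  constructor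
  · intro h
    by_contra hσ
    obtain ⟨τ, hτ⟩ := exists_one_le_sum_vote_of_not_envyFirst hH hσ
    refine h.2 _ (isMatching_graph hH τ) ?_
    simpa only [MorePopular, houseOf_graph hH] using hτ
  · refine fun h => ⟨isMatching_graph hH σ, fun N hN hp => ?_⟩
    obtain ⟨τ, hτ⟩ := hN.exists_equiv hc
    simp only [MorePopular, houseOf_graph hH] at hp
    have h1 := h.sum_vote_le hH τ
    have h2 := Finset.sum_le_sum fun x (_ : x ∈ Finset.univ) =>
      vote_mono (o₂ := some (σ x)) (position_le_of_subset_graph hN hτ x) le_rfl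
    omega

/-- With complete lists and as many houses as applicants, popular matchings are perfect. -/
theorem IsPopular.eq_graph (hN : H.IsPopular N) (hH : ∀ x y, y ∈ H.pref x) (h : N ⊆ graph σ) :
    N = graph σ := by
  by_contra hne
  obtain ⟨e, he, heN⟩ := Finset.exists_of_ssubset (h.ssubset_of_ne hne)
  refine hN.2 _ (isMatching_graph hH σ) ?_
  have h1 : ∀ y, (e.1, y) ∉ N := by
    intro y hy
    have h2 := mem_graph.1 (h hy)
    rw [mem_graph] at he
    apply heN
    rwa [show e = (e.1, y) from Prod.ext rfl (he.symm.trans h2)]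
  simp only [MorePopular, houseOf_graph hH]
  have h3 : vote (H.pref e.1) (some (σ e.1)) (houseOf N e.1) = 1 := by
    rw [houseOf_eq_none h1]
    exact vote_eq_one (List.idxOf_lt_length_of_mem (hH _ _))
  rw [← h3]
  exact Finset.single_le_sum
    (f := fun x => vote (H.pref x) (some (σ x)) (houseOf N x))
    (fun x _ => vote_nonneg (position_le_of_subset_graph hN.1 h x)) (Finset.mem_univ e.1)

theorem exists_isPopular_iff (hH : ∀ x y, y ∈ H.pref x)
    (hc : Fintype.card X = Fintype.card Y) :
    (∃ N, H.IsPopular N) ↔ ∃ σ : X ≃ Y, H.EnvyFirst σ := by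
  constructor
  · rintro ⟨N, hN⟩
    obtain ⟨σ, hσ⟩ := hN.1.exists_equiv hc
    refine ⟨σ, (isPopular_graph_iff hH hc).1 ?_⟩
    rwa [← hN.eq_graph hH hσ]
  · rintro ⟨σ, hσ⟩
    exact ⟨_, (isPopular_graph_iff hH hc).2 hσ⟩

end HouseAllocation

/-! ### First and second choices -/

namespace HouseAllocation

variable {X Y : Type*} [Fintype X] [Fintype Y] [DecidableEq X] [DecidableEq Y]
  {H : HouseAllocation X Y} {f s : X → Y} {σ : X ≃ Y}

/-- `f x` is the first choice of `x`, and `s x` is the best house on the list of `x` that is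
nobody's first choice. If every house is somebody's first choice, then `s x` is `f x` instead. -/
structure IsFirstSecond (H : HouseAllocation X Y) (f s : X → Y) : Prop where
  idxOf_first : ∀ x, (H.pref x).idxOf (f x) = 0
  second : ∀ x, (s x ∉ Set.range f ∧
      ∀ y, (H.pref x).idxOf y < (H.pref x).idxOf (s x) → y ∈ Set.range f) ∨
    (s x = f x ∧ ∀ y, y ∈ Set.range f)

theorem EnvyFirst.eq_first_or_second (hσ : H.EnvyFirst σ) (hH : ∀ x y, y ∈ H.pref x)
    (h : H.IsFirstSecond f s) (x : X) : σ x = f x ∨ σ x = s x := by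
  by_contra! hx
  -- `σ x` is nobody's first choice: otherwise an applicant `b` with this first choice envies `x`.
  have h1 : σ x ∉ Set.range f := by
    rintro ⟨b, hb⟩
    have hbx : b ≠ x := by rintro rfl; exact hx.1 hb.symm
    have h2 : (H.pref b).idxOf (σ b) ≠ 0 := fun h0 =>
      hbx (σ.injective ((List.idxOf_inj (hH _ _)).1
        (h0.trans (by rw [← hb, h.idxOf_first b]) : _ = (H.pref b).idxOf (σ x))))
    have h3 := hσ b (σ x) (by rw [← hb, h.idxOf_first b]; omega)
    rw [Equiv.symm_apply_apply] at h3
    exact hx.1 ((List.idxOf_inj (hH _ _)).1 (h3.trans (h.idxOf_first x).symm))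
  rcases h.second x with ⟨h2, h3⟩ | ⟨_, h3⟩
  · rcases lt_trichotomy ((H.pref x).idxOf (σ x)) ((H.pref x).idxOf (s x)) with h4 | h4 | h4
    · exact h1 (h3 _ h4)
    · exact hx.2 ((List.idxOf_inj (hH _ _)).1 h4)
    · have h5 := hσ _ _ h4
      exact h2 ⟨σ.symm (s x), (List.idxOf_inj (hH _ _)).1 ((h.idxOf_first _).trans h5.symm)⟩
  · exact h1 (h3 _)

/-- Only first choices precede the second choice of an applicant, and whoever holds a house that is
somebody's first choice has it as its own first choice. -/
theorem IsFirstSecond.envyFirst (h : H.IsFirstSecond f s) (hσ : ∀ x, σ x = f x ∨ σ x = s x) :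
    H.EnvyFirst σ := by
  intro x y hxy
  have h1 : y ∈ Set.range f := by
    rcases h.second x with ⟨_, h3⟩ | ⟨h2, h3⟩
    · rcases hσ x with h4 | h4
      · rw [h4, h.idxOf_first] at hxy
        omega
      · exact h3 _ (by rwa [← h4])
    · exact h3 _
  have h5 := h.idxOf_first (σ.symm y)
  obtain ⟨z, rfl⟩ := σ.surjective y
  rw [Equiv.symm_apply_apply] at h5 ⊢
  rcases hσ z with h4 | h4
  · rwa [h4]
  · rcases h.second z with ⟨h6, _⟩ | ⟨h6, _⟩
    · exact absurd (h4 ▸ h1) h6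
    · rwa [h4, h6]

/-- Finding a popular matching means to assign to each applicant one of two houses. -/
theorem IsFirstSecond.envyFirst_iff (h : H.IsFirstSecond f s) (hH : ∀ x y, y ∈ H.pref x) :
    H.EnvyFirst σ ↔ ∀ x, σ x = f x ∨ σ x = s x :=
  ⟨fun hσ => hσ.eq_first_or_second hH h, h.envyFirst⟩

end HouseAllocation

/-! ### Reduction of the three-dimensional problem to house allocation -/

namespace CyclicInstance

open HouseAllocation

variable {n : ℕ} {I : CyclicInstance n} {M : Finset (Triple n)} {σ τ : Fin n ≃ Fin n}

/-- The three-dimensional matching composed of perfect matchings of `(A, B)` and `(B, C)`. -/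
def triples (σ τ : Fin n ≃ Fin n) : Finset (Triple n) :=
  Finset.univ.image fun a => (a, σ a, τ (σ a))

theorem mem_triples {t : Triple n} : t ∈ triples σ τ ↔ σ t.1 = t.2.1 ∧ τ t.2.1 = t.2.2 := by
  obtain ⟨a, b, c⟩ := t
  simp only [triples, Finset.mem_image, Finset.mem_univ, true_and, Prod.mk.injEq]
  constructor
  · rintro ⟨a, rfl, rfl, rfl⟩
    exact ⟨rfl, rfl⟩
  · rintro ⟨rfl, rfl⟩
    exact ⟨a, rfl, rfl, rfl⟩

theorem mem_pairsAB {a b : Fin n} : (a, b) ∈ pairsAB M ↔ ∃ c, (a, b, c) ∈ M := by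
  simp [pairsAB]

theorem mem_pairsBC {b c : Fin n} : (b, c) ∈ pairsBC M ↔ ∃ a, (a, b, c) ∈ M := by
  simp [pairsBC]

theorem partnerA_eq (M : Finset (Triple n)) (a : Fin n) : partnerA M a = houseOf (pairsAB M) a := by
  simp only [partnerA, houseOf, mem_pairsAB]

theorem partnerB_eq (M : Finset (Triple n)) (b : Fin n) : partnerB M b = houseOf (pairsBC M) b := by
  simp only [partnerB, houseOf, mem_pairsBC]

theorem pairsAB_triples : pairsAB (triples σ τ) = graph σ := by
  ext ⟨a, b⟩
  simp [mem_pairsAB, mem_triples, mem_graph]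

theorem pairsBC_triples : pairsBC (triples σ τ) = graph τ := by
  ext ⟨b, c⟩
  simp only [mem_pairsBC, mem_triples, mem_graph]
  exact ⟨fun ⟨_, h⟩ => h.2, fun h => ⟨σ.symm b, σ.apply_symm_apply b, h⟩⟩

theorem Complete.isMatching_triples (hI : I.Complete) (σ τ : Fin n ≃ Fin n) :
    I.IsMatching (triples σ τ) where
  acceptableA _ _ := hI.completeA _ _
  acceptableB _ _ := hI.completeB _ _
  acceptableC _ _ := hI.completeC _ _
  uniqueA t ht u hu h := by
    rw [mem_triples] at ht hu
    have h1 : t.2.1 = u.2.1 := by rw [← ht.1, ← hu.1, h]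
    exact Prod.ext h (Prod.ext h1 (by rw [← ht.2, ← hu.2, h1]))
  uniqueB t ht u hu h := by
    rw [mem_triples] at ht hu
    exact Prod.ext (σ.injective (by rw [ht.1, hu.1, h]))
      (Prod.ext h (by rw [← ht.2, ← hu.2, h]))
  uniqueC t ht u hu h := by
    rw [mem_triples] at ht hu
    have h1 : t.2.1 = u.2.1 := τ.injective (by rw [ht.2, hu.2, h])
    exact Prod.ext (σ.injective (by rw [ht.1, hu.1, h1])) (Prod.ext h1 h)

theorem IsMatching.isMatching_pairsAB (hM : I.IsMatching M) : I.houseAB.IsMatching (pairsAB M) where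
  acceptable := by
    rintro ⟨a, b⟩ h
    obtain ⟨c, hc⟩ := mem_pairsAB.1 h
    exact hM.acceptableA _ hc
  applicant_unique := by
    rintro ⟨a, b⟩ h ⟨a', b'⟩ h' rfl
    obtain ⟨c, hc⟩ := mem_pairsAB.1 h
    obtain ⟨c', hc'⟩ := mem_pairsAB.1 h'
    cases hM.uniqueA _ hc _ hc' rfl
    rfl
  house_unique := by
    rintro ⟨a, b⟩ h ⟨a', b'⟩ h' rfl
    obtain ⟨c, hc⟩ := mem_pairsAB.1 h
    obtain ⟨c', hc'⟩ := mem_pairsAB.1 h'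
    cases hM.uniqueB _ hc _ hc' rfl
    rfl

theorem IsMatching.isMatching_pairsBC (hM : I.IsMatching M) : I.houseBC.IsMatching (pairsBC M) where
  acceptable := by
    rintro ⟨b, c⟩ h
    obtain ⟨a, ha⟩ := mem_pairsBC.1 h
    exact hM.acceptableB _ ha
  applicant_unique := by
    rintro ⟨b, c⟩ h ⟨b', c'⟩ h' rfl
    obtain ⟨a, ha⟩ := mem_pairsBC.1 h
    obtain ⟨a', ha'⟩ := mem_pairsBC.1 h'
    cases hM.uniqueB _ ha _ ha' rfl
    rfl
  house_unique := by
    rintro ⟨b, c⟩ h ⟨b', c'⟩ h' rfl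
    obtain ⟨a, ha⟩ := mem_pairsBC.1 h
    obtain ⟨a', ha'⟩ := mem_pairsBC.1 h'
    cases hM.uniqueC _ ha _ ha' rfl
    rfl

theorem IsMatching.exists_equiv (hM : I.IsMatching M) :
    ∃ σ τ : Fin n ≃ Fin n, pairsAB M ⊆ graph σ ∧ pairsBC M ⊆ graph τ :=
  let ⟨σ, hσ⟩ := hM.isMatching_pairsAB.exists_equiv rfl
  let ⟨τ, hτ⟩ := hM.isMatching_pairsBC.exists_equiv rfl
  ⟨σ, τ, hσ, hτ⟩

theorem subset_triples (hσ : pairsAB M ⊆ graph σ) (hτ : pairsBC M ⊆ graph τ) :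
    M ⊆ triples σ τ := fun ⟨_, _, _⟩ h => mem_triples.2
  ⟨mem_graph.1 (hσ (mem_pairsAB.2 ⟨_, h⟩)), mem_graph.1 (hτ (mem_pairsBC.2 ⟨_, h⟩))⟩

/-- The elections in `A` and in `B` can be won independently of each other, because the matchings
of `(A, B)` and `(B, C)` can be recombined after completing them to perfect ones. -/
theorem isABPopular_iff (hI : I.Complete) (hM : I.IsMatching M) :
    I.IsABPopular M ↔ I.houseAB.IsPopular (pairsAB M) ∧ I.houseBC.IsPopular (pairsBC M) := by
  constructor
  · intro h
    obtain ⟨σ, τ, hσ, hτ⟩ := hM.exists_equiv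
    -- A matching that wins the vote of one class is completed with a matching extending the one
    -- of `M` for the other class, which does not lose the vote of that class.
    refine ⟨⟨hM.isMatching_pairsAB, fun N hN hp => ?_⟩, ⟨hM.isMatching_pairsBC, fun N hN hp => ?_⟩⟩
    · obtain ⟨ρ, hρ⟩ := hN.exists_equiv rfl
      refine h.2 _ (hI.isMatching_triples ρ τ) ?_
      simp only [ABMorePopular, partnerA_eq, partnerB_eq, pairsAB_triples, pairsBC_triples]
      have h1 : _ ≤ ∑ x, vote (I.prefA x) (houseOf (graph ρ) x) (houseOf (pairsAB M) x) :=
        le_trans hp <| Finset.sum_le_sum fun x _ => vote_mono (by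
          rw [houseOf_graph (H := I.houseAB) hI.completeA]
          exact position_le_of_subset_graph hN hρ x) le_rfl
      have h2 : 0 ≤ ∑ x, vote (I.prefB x) (houseOf (graph τ) x) (houseOf (pairsBC M) x) :=
        Finset.sum_nonneg fun x _ => vote_nonneg (by
          rw [houseOf_graph (H := I.houseBC) hI.completeB]
          exact position_le_of_subset_graph hM.isMatching_pairsBC hτ x)
      omega
    · obtain ⟨ρ, hρ⟩ := hN.exists_equiv rfl
      refine h.2 _ (hI.isMatching_triples σ ρ) ?_
      simp only [ABMorePopular, partnerA_eq, partnerB_eq, pairsAB_triples, pairsBC_triples]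
      have h1 : _ ≤ ∑ x, vote (I.prefB x) (houseOf (graph ρ) x) (houseOf (pairsBC M) x) :=
        le_trans hp <| Finset.sum_le_sum fun x _ => vote_mono (by
          rw [houseOf_graph (H := I.houseBC) hI.completeB]
          exact position_le_of_subset_graph hN hρ x) le_rfl
      have h2 : 0 ≤ ∑ x, vote (I.prefA x) (houseOf (graph σ) x) (houseOf (pairsAB M) x) :=
        Finset.sum_nonneg fun x _ => vote_nonneg (by
          rw [houseOf_graph (H := I.houseAB) hI.completeA]
          exact position_le_of_subset_graph hM.isMatching_pairsAB hσ x)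
      omega
  · rintro ⟨hA, hB⟩
    refine ⟨hM, fun M₁ hM₁ hp => ?_⟩
    simp only [ABMorePopular, partnerA_eq, partnerB_eq] at hp
    have h1 := hA.2 _ hM₁.isMatching_pairsAB
    have h2 := hB.2 _ hM₁.isMatching_pairsBC
    simp only [MorePopular, houseAB, houseBC] at h1 h2
    omega

theorem isABPopular_triples_iff (hI : I.Complete) :
    I.IsABPopular (triples σ τ) ↔ I.houseAB.EnvyFirst σ ∧ I.houseBC.EnvyFirst τ := by
  rw [isABPopular_iff hI (hI.isMatching_triples σ τ), pairsAB_triples, pairsBC_triples,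
    isPopular_graph_iff hI.completeA rfl, isPopular_graph_iff hI.completeB rfl]

theorem exists_isABPopular_iff (hI : I.Complete) :
    (∃ M, I.IsABPopular M) ↔ (∃ N, I.houseAB.IsPopular N) ∧ (∃ N, I.houseBC.IsPopular N) := by
  constructor
  · rintro ⟨M, hM⟩
    have h := (isABPopular_iff hI hM.1).1 hM
    exact ⟨⟨_, h.1⟩, ⟨_, h.2⟩⟩
  · rw [exists_isPopular_iff hI.completeA rfl, exists_isPopular_iff hI.completeB rfl]
    rintro ⟨⟨σ, hσ⟩, ⟨τ, hτ⟩⟩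
    exact ⟨_, (isABPopular_triples_iff hI).2 ⟨hσ, hτ⟩⟩

theorem card_triples (σ τ : Fin n ≃ Fin n) : (triples σ τ).card = n := by
  rw [triples, Finset.card_image_of_injective _ fun _ _ h => congrArg Prod.fst h]
  simp

/-- Only perfect matchings are popular, as all lists are complete. -/
theorem IsABPopular.eq_triples (hM : I.IsABPopular M) (hI : I.Complete)
    (hσ : pairsAB M ⊆ graph σ) (hτ : pairsBC M ⊆ graph τ) : M = triples σ τ := by
  have h := ((isABPopular_iff hI hM.1).1 hM).1.eq_graph hI.completeA hσ
  refine (subset_triples hσ hτ).antisymm fun ⟨a, b, c⟩ ht => ?_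
  rw [mem_triples] at ht
  obtain ⟨c', hc'⟩ := mem_pairsAB.1 (h ▸ mem_graph.2 ht.1 : (a, b) ∈ pairsAB M)
  have h' := (mem_triples.1 (subset_triples hσ hτ hc')).2
  rwa [show c = c' from ht.2.symm.trans h']

end CyclicInstance

/-! ### Matchings in which every applicant has two options -/

namespace TwoChoice

variable {X Y : Type*} [DecidableEq X] [DecidableEq Y] {f s : X → Y} {occ : Y → Option X}

/-- The option of `x` other than `y`. -/
def other (f s : X → Y) (x : X) (y : Y) : Y := if y = f x then s x else f x

/-- Starting at the house `y` and moving repeatedly from a house to the other option of its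
occupant, one arrives at a free house after exactly `t` moves. -/
inductive Dist (f s : X → Y) (occ : Y → Option X) : Y → ℕ → Prop
  | free {y : Y} (h : occ y = none) : Dist f s occ y 0
  | step {y : Y} {x : X} {t : ℕ} (h : occ y = some x) (ht : Dist f s occ (other f s x y) t) :
      Dist f s occ y (t + 1)

theorem Dist.unique {y : Y} {t t' : ℕ} (h : Dist f s occ y t) (h' : Dist f s occ y t') :
    t = t' := by
  induction h generalizing t' with
  | free h =>
    cases h' with
    | free => rfl
    | step h1 => rw [h] at h1; cases h1
  | step h ht ih =>
    cases h' with
    | free h1 => rw [h] at h1; cases h1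
    | step h1 h2 =>
      rw [h] at h1
      cases h1
      rw [ih h2]

/-- Changing the occupant of a house does not affect the walks from houses nearer to a free one. -/
theorem Dist.update {y z : Y} {t r : ℕ} (h : Dist f s occ y t) (hz : Dist f s occ z r) (hr : t < r)
    (o : Option X) : Dist f s (Function.update occ z o) y t := by
  have hne : ∀ {y t}, Dist f s occ y t → t < r → y ≠ z := by
    rintro y t h ht rfl
    exact ht.ne (h.unique hz)
  induction h with
  | free h => exact .free (by rwa [Function.update_of_ne (hne (.free h) hr)])
  | step h ht ih =>
    exact .step (by rwa [Function.update_of_ne (hne (.step h ht) hr)]) (ih (by omega))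

theorem Dist.exists_of_le {y : Y} {t : ℕ} (h : Dist f s occ y t) {r : ℕ} (hr : r ≤ t) :
    ∃ z, Dist f s occ z r := by
  induction h with
  | free h => exact ⟨_, by rw [Nat.le_zero.1 hr]; exact .free h⟩
  | step h ht ih =>
    rcases hr.lt_or_eq with h1 | rfl
    · exact ih (by omega)
    · exact ⟨_, .step h ht⟩

/-- A walk to a free house meets each house at most once, as the distances decrease. -/
theorem Dist.lt_card [Fintype Y] {y : Y} {t : ℕ} (h : Dist f s occ y t) : t < Fintype.card Y := by
  choose g hg using fun r : Fin (t + 1) => h.exists_of_le (Nat.le_of_lt_succ r.2)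
  have hinj : Function.Injective g := fun r r' hrr =>
    Fin.ext ((hg r).unique (hrr ▸ hg r'))
  simpa using Fintype.card_le_of_injective g hinj

/-- One move of the walk; it stays at a free house. -/
def move (f s : X → Y) (occ : Y → Option X) (y : Y) : Y :=
  match occ y with
  | none => y
  | some x => other f s x y

/-- If the walk leads to a free house at all, it does so within as many moves as there are houses.
-/
theorem exists_dist_iff [Fintype Y] {y : Y} :
    (∃ t, Dist f s occ y t) ↔ occ ((move f s occ)^[Fintype.card Y] y) = none := by
  have key : ∀ m y, occ ((move f s occ)^[m] y) = none ↔ ∃ t ≤ m, Dist f s occ y t := by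
    intro m
    induction m with
    | zero =>
      intro y
      refine ⟨fun h => ⟨0, le_rfl, .free h⟩, fun ⟨t, ht, h⟩ => ?_⟩
      cases h with
      | free h => exact h
      | step => omega
    | succ m ih =>
      intro y
      rw [Function.iterate_succ_apply, ih]
      cases hy : occ y with
      | none =>
        rw [show move f s occ y = y by simp [move, hy]]
        exact ⟨fun _ => ⟨0, by omega, .free hy⟩, fun _ => ⟨0, by omega, .free hy⟩⟩
      | some x =>
        rw [show move f s occ y = other f s x y by simp [move, hy]]
        refine ⟨fun ⟨t, ht, h⟩ => ⟨t + 1, by omega, .step hy h⟩, fun ⟨t, ht, h⟩ => ?_⟩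
        cases h with
        | free h => rw [hy] at h; cases h
        | step h1 h2 =>
          rw [hy] at h1
          cases h1
          exact ⟨_, by omega, h2⟩
  rw [key]
  exact ⟨fun ⟨t, h⟩ => ⟨t, h.lt_card.le, h⟩, fun ⟨t, _, h⟩ => ⟨t, h⟩⟩

/-- `occ` assigns exactly the applicants in `S`, each to one of its two options. -/
structure Assigns (f s : X → Y) (occ : Y → Option X) (S : Set X) : Prop where
  option : ∀ {y x}, occ y = some x → x ∈ S ∧ (y = f x ∨ y = s x)
  exists_house : ∀ x ∈ S, ∃ y, occ y = some x
  unique : ∀ {y z x}, occ y = some x → occ z = some x → y = z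

theorem Assigns.empty : Assigns f s (fun _ => none) ∅ :=
  by
  refine ⟨fun h => ?_, fun _ h => h.elim, fun h => ?_⟩ <;> cases h

/-- Holds for every `y`, also if `y` is not an option of `x`. -/
theorem other_eq (x : X) (y : Y) :
    other f s x y = f x ∨ other f s x y = s x := by
  unfold other
  split_ifs <;> simp

/-- An applicant takes an option, and the occupant of that house, if any, has to leave. The set of
assigned applicants is described without a case distinction on whether there is an occupant. -/
theorem Assigns.update {S : Set X} (h : Assigns f s occ S) {x : X} (hx : x ∉ S) {y : Y}
    (hy : y = f x ∨ y = s x) :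
    Assigns f s (Function.update occ y (some x)) {z | (z = x ∨ z ∈ S) ∧ occ y ≠ some z} where
  option := by
    intro z w hz
    by_cases hzy : z = y
    · subst hzy
      rw [Function.update_self] at hz
      cases hz
      exact ⟨⟨.inl rfl, fun h1 => hx (h.option h1).1⟩, hy⟩
    · rw [Function.update_of_ne hzy] at hz
      exact ⟨⟨.inr (h.option hz).1, fun h1 => hzy (h.unique hz h1)⟩, (h.option hz).2⟩
  exists_house := by
    rintro z ⟨rfl | hz, h1⟩
    · exact ⟨y, Function.update_self ..⟩
    · obtain ⟨w, hw⟩ := h.exists_house z hz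
      exact ⟨w, by rw [Function.update_of_ne (by rintro rfl; exact h1 hw), hw]⟩
  unique := by
    have key : ∀ {a w}, Function.update occ y (some x) a = some w →
        (a = y ∧ w = x) ∨ (occ a = some w ∧ w ≠ x) := by
      intro a w ha
      by_cases hay : a = y
      · subst hay
        rw [Function.update_self] at ha
        cases ha
        exact .inl ⟨rfl, rfl⟩
      · rw [Function.update_of_ne hay] at ha
        exact .inr ⟨ha, by rintro rfl; exact hx (h.option ha).1⟩
    intro a b w ha hb
    rcases key ha with ⟨h1, h2⟩ | ⟨h1, h2⟩ <;> rcases key hb with ⟨h3, h4⟩ | ⟨h3, h4⟩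
    · rw [h1, h3]
    · exact absurd h2 h4
    · exact absurd h4 h2
    · exact h.unique h1 h3

/-- If neither option of a new applicant leads to a free house, then the houses not leading to a
free one are the only options of their occupants and of the new applicant, one applicant too
many. -/
theorem Assigns.not_exists_injective [Fintype Y] {S : Set X} (h : Assigns f s occ S) {x : X}
    (hx : x ∉ S) (hf : ¬ ∃ t, Dist f s occ (f x) t) (hs : ¬ ∃ t, Dist f s occ (s x) t) :
    ¬ ∃ σ : X → Y, Function.Injective σ ∧ ∀ x, σ x = f x ∨ σ x = s x := by
  rintro ⟨σ, hσ, hopt⟩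
  let B : Set Y := {y | ¬ ∃ t, Dist f s occ y t}
  have hB : ∀ y : B, ∃ z, occ y = some z := by
    rintro ⟨y, hy⟩
    cases h1 : occ y with
    | none => exact absurd ⟨0, .free h1⟩ hy
    | some z => exact ⟨z, rfl⟩
  choose g hg using hB
  have hother : ∀ y : B, other f s (g y) y ∈ B := by
    rintro ⟨y, hy⟩ ⟨t, ht⟩
    exact hy ⟨t + 1, .step (hg ⟨y, hy⟩) ht⟩
  have hgB : ∀ y : B, f (g y) ∈ B ∧ s (g y) ∈ B := by
    intro y
    have h1 := hother y
    have h2 := y.2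
    rcases (h.option (hg y)).2 with h3 | h3
    · rw [other, if_pos h3] at h1
      exact ⟨h3 ▸ h2, h1⟩
    · by_cases h4 : (y : Y) = f (g y)
      · rw [other, if_pos h4] at h1
        exact ⟨h4 ▸ h2, h1⟩
      · rw [other, if_neg h4] at h1
        exact ⟨h1, h3 ▸ h2⟩
  have hσB : ∀ z, f z ∈ B → s z ∈ B → σ z ∈ B := fun z h1 h2 => by
    rcases hopt z with h3 | h3 <;> rw [h3] <;> assumption
  -- An injection from `B` and one further element into `B`.
  let φ : Option B → B := fun o => match o with
    | none => ⟨σ x, hσB x hf hs⟩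
    | some y => ⟨σ (g y), hσB _ (hgB y).1 (hgB y).2⟩
  have hgx : ∀ y, g y ≠ x := fun y h1 => hx (h1 ▸ (h.option (hg y)).1)
  have hφ : Function.Injective φ := by
    rintro (_ | y) (_ | z) hyz
    · rfl
    · exact absurd (hσ (congrArg Subtype.val hyz)).symm (hgx z)
    · exact absurd (hσ (congrArg Subtype.val hyz)) (hgx y)
    · have h1 : g y = g z := hσ (congrArg Subtype.val hyz)
      rw [Subtype.ext (h.unique (hg y) (h1 ▸ hg z))]
  classical
  have := Fintype.card_le_of_injective φ hφ
  simp at this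

/-- Assigning everybody amounts to a bijection, if there are as many houses as applicants. -/
theorem Assigns.exists_equiv [Fintype X] [Fintype Y] (h : Assigns f s occ Set.univ)
    (hc : Fintype.card X = Fintype.card Y) :
    ∃ σ : X ≃ Y, (∀ y, occ y = some (σ.symm y)) ∧ ∀ x, σ x = f x ∨ σ x = s x := by
  choose g hg using fun x => h.exists_house x trivial
  have hinj : Function.Injective g := fun x x' hx =>
    Option.some.inj ((hg x).symm.trans ((congrArg occ hx).trans (hg x')))
  let σ := Equiv.ofBijective g ((Fintype.bijective_iff_injective_and_card g).2 ⟨hinj, hc⟩)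
  refine ⟨σ, fun y => ?_, fun x => (h.option (hg x)).2⟩
  obtain ⟨x, rfl⟩ := σ.surjective y
  rw [Equiv.symm_apply_apply]
  exact hg x

end TwoChoice

/-! ### Total correctness with time bounds for the random access machine -/

namespace RAM

/-- All words of the state are at most `W`. -/
def State.Bounded (W : ℕ) (σ : State) : Prop := (∀ r, σ.reg r ≤ W) ∧ ∀ a, σ.mem a ≤ W

/-- The weakest precondition with word bound `W` and time bound `k`: started in `σ`, provided that
its words are at most `W`, the program `p` halts after at most `k` steps, in a state with words at
most `W` that satisfies `Q`. -/
def WP (W : ℕ) (p : Prog) (k : ℕ) (Q : State → Prop) (σ : State) : Prop :=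
  σ.Bounded W → ∃ k' ≤ k, ∃ τ, Run W p σ k' τ ∧ τ.Bounded W ∧ Q τ

/-- The side condition for an instruction to produce a word at most `W` in a state all of whose
words are at most `W`: only constants and sums can be larger. -/
def Instr.Safe (W : ℕ) : Instr → State → Prop
  | const _ k, _ => k ≤ W
  | add _ s t, σ => σ.reg s + σ.reg t ≤ W
  | _, _ => True

theorem Instr.Safe.word_le {W : ℕ} {i : Instr} {σ : State} (h : i.Safe W σ) (hσ : σ.Bounded W) :
    i.word σ ≤ W := by
  cases i with
  | const r k => exact h
  | copy r s => exact hσ.1 s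
  | add r s t => exact h
  | sub r s t => exact (Nat.sub_le _ _).trans (hσ.1 s)
  | load r s => exact hσ.2 _
  | store r s => exact hσ.1 s

theorem State.Bounded.exec {W : ℕ} {σ : State} (hσ : σ.Bounded W) {i : Instr}
    (h : i.word σ ≤ W) : (i.exec σ).Bounded W := by
  have key : ∀ {g : ℕ → ℕ} {a v : ℕ}, (∀ x, g x ≤ W) → v ≤ W →
      ∀ x, Function.update g a v x ≤ W := by
    intro g a v hg hv x
    rw [Function.update_apply]
    split_ifs
    exacts [hv, hg x]
  cases i <;> first | exact ⟨key hσ.1 h, hσ.2⟩ | exact ⟨hσ.1, key hσ.2 h⟩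

/-- Straight-line code. -/
def block : List Instr → Prog
  | [] => .skip
  | i :: l => .seq (.instr i) (block l)

/-- The effect of straight-line code. -/
def execs : List Instr → State → State
  | [], σ => σ
  | i :: l, σ => execs l (i.exec σ)

/-- The side condition for straight-line code. -/
def Safes (W : ℕ) : List Instr → State → Prop
  | [], _ => True
  | i :: l, σ => i.Safe W σ ∧ Safes W l (i.exec σ)

/-- `p` writes only registers below `q`. -/
def Prog.writesBelow (q : ℕ) : Prog → Bool
  | .skip => true
  | .instr (.const r _) => decide (r < q)
  | .instr (.copy r _) => decide (r < q)
  | .instr (.add r _ _) => decide (r < q)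
  | .instr (.sub r _ _) => decide (r < q)
  | .instr (.load r _) => decide (r < q)
  | .instr (.store _ _) => true
  | .seq p p' => p.writesBelow q && p'.writesBelow q
  | .ite _ p p' => p.writesBelow q && p'.writesBelow q
  | .while _ p => p.writesBelow q

theorem Run.reg_eq {W q k : ℕ} {p : Prog} {σ τ : State} (h : Run W p σ k τ)
    (hp : p.writesBelow q = true) : ∀ r, q ≤ r → τ.reg r = σ.reg r := by
  induction h with
  | skip => exact fun _ _ => rfl
  | instr i σ _ =>
    intro r hr
    cases i <;> first
      | rfl
      | exact Function.update_of_ne (by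
          simp only [Prog.writesBelow, decide_eq_true_eq] at hp; omega) _ _
  | seq _ _ ih ih' =>
    simp only [Prog.writesBelow, Bool.and_eq_true] at hp
    exact fun r hr => (ih' hp.2 r hr).trans (ih hp.1 r hr)
  | iteTrue _ _ ih =>
    simp only [Prog.writesBelow, Bool.and_eq_true] at hp
    exact ih hp.1
  | iteFalse _ _ ih =>
    simp only [Prog.writesBelow, Bool.and_eq_true] at hp
    exact ih hp.2
  | whileTrue _ _ _ ih ih' => exact fun r hr => (ih' hp r hr).trans (ih hp r hr)
  | whileFalse => exact fun _ _ => rfl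

variable {W k l : ℕ} {p p' : Prog} {Q R : State → Prop} {σ : State}

theorem WP.mono (h : WP W p k R σ) (hQ : ∀ τ, R τ → Q τ) : WP W p k Q σ := fun hσ =>
  let ⟨k', hk, τ, hr, hb, hR⟩ := h hσ
  ⟨k', hk, τ, hr, hb, hQ τ hR⟩

theorem WP.le (h : WP W p k Q σ) (hk : k ≤ l) : WP W p l Q σ := fun hσ =>
  let ⟨k', hk', h'⟩ := h hσ
  ⟨k', hk'.trans hk, h'⟩

/-- Registers not written by the program keep their values. In all uses, subroutines write only
registers below `10`, their callers registers below `20`, and the registers from `20` on hold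
parameters. -/
theorem WP.frame (q : ℕ) (hp : p.writesBelow q = true) (h : WP W p k R σ)
    (hQ : ∀ τ, (∀ r, q ≤ r → τ.reg r = σ.reg r) → R τ → Q τ) : WP W p k Q σ := fun hσ =>
  let ⟨k', hk, τ, hr, hb, hR⟩ := h hσ
  ⟨k', hk, τ, hr, hb, hQ τ (hr.reg_eq hp) hR⟩

theorem WP.seq (h : WP W p k (WP W p' l Q) σ) : WP W (.seq p p') (k + l) Q σ := fun hσ =>
  let ⟨k', hk, _, hr, hb, hR⟩ := h hσ
  let ⟨l', hl, υ, hr', hb', hQ⟩ := hR hb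
  ⟨k' + l', Nat.add_le_add hk hl, υ, .seq hr hr', hb', hQ⟩

theorem WP.block {L : List Instr} (hs : Safes W L σ) (h : Q (execs L σ)) :
    WP W (block L) (L.length + 1) Q σ := by
  induction L generalizing σ with
  | nil => exact fun hσ => ⟨1, le_rfl, σ, .skip σ, hσ, h⟩
  | cons i L ih =>
    intro hσ
    have hw := hs.1.word_le hσ
    obtain ⟨k', hk, τ, hr, hb, hQ⟩ := ih hs.2 h (hσ.exec hw)
    exact ⟨1 + k', by rw [List.length_cons]; omega, τ, .seq (.instr i σ hw) hr, hb, hQ⟩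

theorem WP.block_seq {L : List Instr} (hs : Safes W L σ) (h : WP W p k Q (execs L σ)) :
    WP W (.seq (RAM.block L) p) (L.length + 1 + k) Q σ :=
  WP.seq (WP.block hs h)

theorem WP.ite {c : Test} (ht : c.Holds σ → WP W p k Q σ) (hf : ¬ c.Holds σ → WP W p' k Q σ) :
    WP W (.ite c p p') (k + 1) Q σ := fun hσ => by
  by_cases hc : c.Holds σ
  · obtain ⟨k', hk, τ, hr, h⟩ := ht hc hσ
    exact ⟨k' + 1, by omega, τ, .iteTrue hc hr, h⟩
  · obtain ⟨k', hk, τ, hr, h⟩ := hf hc hσ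
    exact ⟨k' + 1, by omega, τ, .iteFalse hc hr, h⟩

/-- The rule for loops: `I m` is an invariant that allows at most `m` further rounds of at most `k`
steps, and the test takes one step in each round and one at the end. -/
theorem WP.while {c : Test} (q : ℕ) (hp : p.writesBelow q = true) (I : ℕ → State → Prop) {m : ℕ}
    (hI : I m σ)
    (step : ∀ m τ, (∀ r, q ≤ r → τ.reg r = σ.reg r) → I m τ → c.Holds τ →
      ∃ m', m' + 1 = m ∧ WP W p k (I m') τ)
    (done : ∀ m τ, (∀ r, q ≤ r → τ.reg r = σ.reg r) → I m τ → ¬ c.Holds τ → Q τ) :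
    WP W (.while c p) (m * (k + 1) + 1) Q σ := by
  have key : ∀ m τ, (∀ r, q ≤ r → τ.reg r = σ.reg r) → I m τ →
      WP W (.while c p) (m * (k + 1) + 1) Q τ := by
    intro m
    induction m with
    | zero =>
      intro τ hτ h hb
      have hc : ¬ c.Holds τ := fun hc => by
        obtain ⟨m', hm, _⟩ := step _ τ hτ h hc
        omega
      exact ⟨1, by omega, τ, .whileFalse hc, hb, done _ τ hτ h hc⟩
    | succ m ih =>
      intro τ hτ h hb
      by_cases hc : c.Holds τ
      · obtain ⟨m', hm, hw⟩ := step _ τ hτ h hc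
        obtain rfl : m' = m := by omega
        obtain ⟨k₁, hk₁, υ, hr, hbυ, hυ⟩ := hw hb
        obtain ⟨k₂, hk₂, ω, hr', h'⟩ :=
          ih υ (fun r hr' => (hr.reg_eq hp r hr').trans (hτ r hr')) hυ hbυ
        exact ⟨k₁ + k₂ + 1, by rw [Nat.succ_mul]; omega, ω, .whileTrue hc hr hr', h'⟩
      · exact ⟨1, by omega, τ, .whileFalse hc, hb, done _ τ hτ h hc⟩
  exact key m σ (fun _ _ => rfl) hI

theorem execs_reg {q : ℕ} {L : List Instr} (h : (RAM.block L).writesBelow q = true) (σ : State) :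
    ∀ r, q ≤ r → (execs L σ).reg r = σ.reg r := by
  induction L generalizing σ with
  | nil => exact fun _ _ => rfl
  | cons i L ih =>
    simp only [RAM.block, Prog.writesBelow, Bool.and_eq_true] at h
    intro r hr
    refine (ih h.2 _ r hr).trans ?_
    cases i <;> first
      | rfl
      | exact Function.update_of_ne (by
          have := h.1; simp only [Prog.writesBelow, decide_eq_true_eq] at this; omega) _ _

section Evaluation

attribute [simp] Safes Instr.Safe execs Test.Holds


variable {r s t a : ℕ}

@[simp] theorem exec_const : (Instr.const r a).exec σ = ⟨Function.update σ.reg r a, σ.mem⟩ := rfl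

@[simp] theorem exec_copy :
    (Instr.copy r s).exec σ = ⟨Function.update σ.reg r (σ.reg s), σ.mem⟩ := rfl

@[simp] theorem exec_add :
    (Instr.add r s t).exec σ = ⟨Function.update σ.reg r (σ.reg s + σ.reg t), σ.mem⟩ := rfl

@[simp] theorem exec_sub :
    (Instr.sub r s t).exec σ = ⟨Function.update σ.reg r (σ.reg s - σ.reg t), σ.mem⟩ := rfl

@[simp] theorem exec_load :
    (Instr.load r s).exec σ = ⟨Function.update σ.reg r (σ.mem (σ.reg s)), σ.mem⟩ := rfl

@[simp] theorem exec_store :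
    (Instr.store r s).exec σ = ⟨σ.reg, Function.update σ.mem (σ.reg r) (σ.reg s)⟩ := rfl

end Evaluation

/-- The memory holds the values of `g` from address `a` on. -/
def Holds {n : ℕ} (mem : ℕ → ℕ) (a : ℕ) (g : Fin n → ℕ) : Prop := ∀ x : Fin n, mem (a + x) = g x

theorem Holds.update {n a v : ℕ} {mem : ℕ → ℕ} {g : Fin n → ℕ} (h : Holds mem a g) (x : Fin n) :
    Holds (Function.update mem (a + x) v) a (Function.update g x v) := by
  intro y
  by_cases hy : y = x
  · subst hy
    simp
  · rw [Function.update_of_ne hy, Function.update_of_ne, h y]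
    exact fun h1 => hy (Fin.ext (by omega))

theorem Holds.congr {n a : ℕ} {mem mem' : ℕ → ℕ} {g : Fin n → ℕ} (h : Holds mem a g)
    (hm : ∀ x, a ≤ x → x < a + n → mem' x = mem x) : Holds mem' a g := fun x => by
  rw [hm _ (by omega) (by omega), h x]

/-- From address `a` on, the memory holds the preference lists, each followed by the word `n`; in
the encoding of an instance with complete lists, this is the length of the next list. -/
def HoldsLists {n : ℕ} (mem : ℕ → ℕ) (a : ℕ) (pref : Fin n → List (Fin n)) : Prop :=
  ∀ x : Fin n, mem (a + x * (n + 1) + n) = n ∧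
    ∀ j (h : j < (pref x).length), mem (a + x * (n + 1) + j) = (pref x)[j]

/-- The row of an applicant, of `n + 1` words, ends within the `n * (n + 1)` words of all rows. -/
theorem row_add_le {n : ℕ} (x : Fin n) : x * (n + 1) + (n + 1) ≤ n * (n + 1) := by
  rw [← Nat.succ_mul]
  exact Nat.mul_le_mul_right _ x.2

theorem HoldsLists.congr {n a : ℕ} {mem mem' : ℕ → ℕ} {pref : Fin n → List (Fin n)}
    (h : HoldsLists mem a pref) (hl : ∀ x, (pref x).length = n)
    (hm : ∀ x, x < a + n * (n + 1) → mem' x = mem x) : HoldsLists mem' a pref := fun x => by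
  have := row_add_le x
  refine ⟨by rw [hm _ (by omega), (h x).1], fun j hj => ?_⟩
  have := hl x
  rw [hm _ (by omega), (h x).2 j hj]

end RAM

/-! ### Finding the first and second choices -/

namespace RAM

/-- The read-only registers of the programs for a house allocation instance: the size `n`, the
address `a` of the first entry of the first preference list, the distance `n + 1` of consecutive
lists, and the addresses of three arrays of `n + 1` words of scratch memory, which begins at `S`.
-/
structure Setup (n a S : ℕ) (σ : State) : Prop where
  one : σ.reg 20 = 1
  size : σ.reg 21 = n
  stride : σ.reg 22 = n + 1
  lists : σ.reg 23 = a
  arr₁ : σ.reg 24 = S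
  arr₂ : σ.reg 25 = S + (n + 1)
  arr₃ : σ.reg 26 = S + 2 * (n + 1)
  zero : σ.reg 27 = 0

theorem Setup.congr {n a S : ℕ} {σ τ : State} (h : Setup n a S σ)
    (hτ : ∀ r, 20 ≤ r → τ.reg r = σ.reg r) : Setup n a S τ := by
  obtain ⟨h1, h2, h3, h4, h5, h6, h7, h8⟩ := h
  constructor <;> rw [hτ _ (by norm_num)] <;> assumption

/-- Mark the first choices in the first array. Registers `10` and `11` hold an applicant and the
address of the first entry of its list. -/
def markFirst : Prog :=
  .seq (block [.const 10 0, .copy 11 23])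
    (.while (.lt 10 21)
      (block [.load 12 11, .add 0 24 12, .store 0 20, .add 11 11 22, .add 10 10 20]))

variable {W n a S : ℕ} {σ : State} {f s : Fin n → Fin n}

open Classical in
theorem wp_markFirst (hσ : Setup n a S σ) (ha : a + n * (n + 1) ≤ S) (hW : S + 3 * (n + 1) ≤ W)
    (hf : ∀ x : Fin n, σ.mem (a + x * (n + 1)) = f x)
    (hz : ∀ x, S ≤ x → x < S + 3 * (n + 1) → σ.mem x = 0) :
    WP W markFirst (7 * n + 4) (fun τ =>
      Holds (n := n) τ.mem S (fun y => if y ∈ Set.range f then 1 else 0) ∧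
      ∀ x, (x < S ∨ S + n ≤ x) → τ.mem x = σ.mem x) σ := by
  refine (WP.block_seq (k := n * 7 + 1) ?_ <| WP.while (k := 6) 20 rfl (fun m τ => ∃ i, m + i = n ∧
    τ.reg 10 = i ∧ τ.reg 11 = a + i * (n + 1) ∧
    Holds (n := n) τ.mem S (fun y => if ∃ x : Fin n, x < i ∧ f x = y then 1 else 0) ∧
    ∀ x, (x < S ∨ S + n ≤ x) → τ.mem x = σ.mem x) ?_ ?_ ?_).le ?_
  · simp
  · refine ⟨0, by simp, ?_⟩
    simp [hσ.lists]
    intro x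
    simpa using hz (S + x) (by omega) (by omega)
  · rintro m τ hτ ⟨i, hm, h10, h11, hmem, hout⟩ hc
    have hS := hσ.congr fun r hr => (hτ r hr).trans (execs_reg rfl σ r hr)
    simp only [Test.Holds, h10, hS.size] at hc
    have hrow := row_add_le ⟨i, hc⟩
    have hfi : τ.mem (a + i * (n + 1)) = f ⟨i, hc⟩ := by
      rw [hout _ (by simp only at hrow; omega), ← hf]
    simp only at hrow
    refine ⟨m - 1, by omega, WP.block ?_ ⟨i + 1, by omega, ?_⟩⟩
    · simp [h10, h11, hS.one, hS.arr₁, hS.stride, hfi]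
      omega
    · simp [h10, h11, hS.one, hS.arr₁, hS.stride, hfi, Nat.succ_mul]
      refine ⟨by omega, ?_, ?_⟩
      · convert hmem.update (f ⟨i, hc⟩) (v := 1) using 1
        funext y
        by_cases hy : y = f ⟨i, hc⟩
        · rw [hy, Function.update_self, if_pos ⟨⟨i, hc⟩, le_rfl, rfl⟩]
        · rw [Function.update_of_ne hy]
          congr 1
          refine propext ⟨fun ⟨x, hx, hxy⟩ => ⟨x, ?_, hxy⟩, fun ⟨x, hx, hxy⟩ => ⟨x, by omega, hxy⟩⟩
          refine lt_of_le_of_ne hx fun h => hy ?_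
          rw [← hxy]
          exact congrArg f (Fin.ext h)
      · intro x hx
        rw [Function.update_of_ne (by omega), hout x hx]
  · rintro m τ hτ ⟨i, hm, h10, h11, hmem, hout⟩ hc
    have hS := hσ.congr fun r hr => (hτ r hr).trans (execs_reg rfl σ r hr)
    simp only [Test.Holds, h10, hS.size] at hc
    refine ⟨?_, hout⟩
    convert hmem using 3 with y
    exact ⟨fun ⟨x, hx⟩ => ⟨x, by omega, hx⟩, fun ⟨x, _, hx⟩ => ⟨x, hx⟩⟩
  · simp
    omega

/-- Move down a preference list up to the first unmarked house, or to the word `n` after the end of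
the list, which serves as a sentinel since the array of marks is zero at position `n`. -/
def scanMarked : Prog :=
  .seq (block [.copy 1 11, .load 3 1, .add 0 24 3, .load 2 0])
    (.while (.lt 27 2) (block [.add 1 1 20, .load 3 1, .add 0 24 3, .load 2 0]))

variable {H : HouseAllocation (Fin n) (Fin n)}

theorem HoldsLists.le {mem : ℕ → ℕ} {pref : Fin n → List (Fin n)} (h : HoldsLists mem a pref)
    (hl : ∀ x, (pref x).length = n) (x : Fin n) {j : ℕ} (hj : j ≤ n) :
    mem (a + x * (n + 1) + j) ≤ n := by
  rcases hj.lt_or_eq with hj | rfl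
  · rw [(h x).2 j (by rwa [hl])]
    exact Fin.is_le'
  · exact (h x).1.le

theorem length_pref (hH : ∀ x y, y ∈ H.pref x) (x : Fin n) : (H.pref x).length = n := by
  have h1 : (H.pref x).toFinset = Finset.univ := by
    ext y
    simp [hH]
  rw [← List.toFinset_card_of_nodup (H.nodup x), h1, Finset.card_univ, Fintype.card_fin]

open Classical in
theorem wp_scanMarked (hσ : Setup n a S σ) (ha : a + n * (n + 1) ≤ S) (hW : S + 3 * (n + 1) ≤ W)
    (hH : ∀ x y, y ∈ H.pref x) (hl : HoldsLists σ.mem a H.pref)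
    (hmark : Holds (n := n) σ.mem S (fun y => if y ∈ Set.range f then 1 else 0))
    (hz : σ.mem (S + n) = 0) (x : Fin n) (hx : σ.reg 11 = a + x * (n + 1)) :
    WP W scanMarked (6 * n + 6) (fun τ => τ.mem = σ.mem ∧
      ((τ.reg 3 = n ∧ ∀ y, y ∈ Set.range f) ∨ ∃ y : Fin n, τ.reg 3 = y ∧ y ∉ Set.range f ∧
        ∀ z, (H.pref x).idxOf z < (H.pref x).idxOf y → z ∈ Set.range f)) σ := by
  have hrow := row_add_le x
  have hlen := length_pref hH x
  have hle := fun {j : ℕ} => hl.le (length_pref hH) x (j := j)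
  have hle0 : σ.mem (a + x * (n + 1)) ≤ n := hle (Nat.zero_le n)
  refine (WP.block_seq (k := n * 6 + 1) ?_ <| WP.while (k := 5) 20 rfl
    (fun m τ => ∃ j, m + j = n ∧ τ.mem = σ.mem ∧ τ.reg 1 = a + x * (n + 1) + j ∧
      τ.reg 3 = σ.mem (a + x * (n + 1) + j) ∧ τ.reg 2 = σ.mem (S + τ.reg 3) ∧
      ∀ i (hi : i < (H.pref x).length), i < j → (H.pref x)[i] ∈ Set.range f) ?_ ?_ ?_).le ?_
  · simp [hx, hσ.arr₁]
    omega
  · exact ⟨0, by omega, by simp, by simp [hx], by simp [hx], by simp [hx, hσ.arr₁],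
      fun i _ hi => absurd hi (by omega)⟩
  · rintro m τ hτ ⟨j, hm, hmem, h1, h3, h2, hj⟩ hc
    have hS := hσ.congr fun r hr => (hτ r hr).trans (execs_reg rfl σ r hr)
    simp only [Test.Holds, hS.zero] at hc
    -- The sentinel is not marked, so the current entry is a house.
    have hjn : j < n := by
      by_contra hjn
      obtain rfl : j = n := by omega
      rw [h2, h3, (hl x).1, hz] at hc
      omega
    have hfj : (H.pref x)[j] ∈ Set.range f := by
      by_contra hfj
      have h5 := hmark (H.pref x)[j]
      simp only [if_neg hfj] at h5
      rw [h2, h3, (hl x).2 j (by omega), h5] at hc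
      omega
    have hle' := hle (j := j + 1) hjn
    rw [← add_assoc] at hle'
    refine ⟨m - 1, by omega, WP.block ?_ ⟨j + 1, by omega, ?_⟩⟩
    · simp [h1, hmem, hS.one, hS.arr₁]
      omega
    · refine ⟨by simp [hmem], by simp [h1, hS.one, add_assoc],
        by simp [h1, hmem, hS.one, add_assoc],
        by simp [h1, hmem, hS.one, hS.arr₁], fun i hi hij => ?_⟩
      rcases (Nat.lt_succ_iff.1 hij).lt_or_eq with h | rfl
      · exact hj i hi h
      · exact hfj
  · rintro m τ hτ ⟨j, hm, hmem, h1, h3, h2, hj⟩ hc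
    have hS := hσ.congr fun r hr => (hτ r hr).trans (execs_reg rfl σ r hr)
    simp only [Test.Holds, hS.zero] at hc
    have key : ∀ z, (H.pref x).idxOf z < j → z ∈ Set.range f := fun z hz' => by
      have h5 := hj _ (List.idxOf_lt_length_of_mem (hH x z)) hz'
      rwa [List.getElem_idxOf] at h5
    refine ⟨hmem, ?_⟩
    rcases (show j ≤ n by omega).lt_or_eq with hjn | rfl
    · refine .inr ⟨(H.pref x)[j], by rw [h3, (hl x).2 j (by omega)], fun hfj => hc ?_,
        fun z hz' => key z ?_⟩
      · have h5 := hmark (H.pref x)[j]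
        simp only [if_pos hfj] at h5
        rw [h2, h3, (hl x).2 j (by omega), h5]
        exact one_pos
      · rwa [(H.nodup x).idxOf_getElem] at hz'
    · refine .inl ⟨by rw [h3, (hl x).1], fun z => key z ?_⟩
      have := List.idxOf_lt_length_of_mem (hH x z)
      omega
  · simp
    omega

/-- Store the sums of the first and second choices in the second array, at positions `1` to `n`. If
the list has no unmarked house, the first choice is used in place of the second. -/
def findSecond : Prog :=
  .seq (block [.const 10 0, .copy 11 23])
    (.while (.lt 10 21)
      (.seq scanMarked
        (.seq (block [.load 12 11])
          (.seq (.ite (.eq 3 21) (block [.copy 3 12]) (block []))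
            (block [.add 3 3 12, .add 10 10 20, .add 0 25 10, .store 0 3, .add 11 11 22])))))

open Classical in
theorem wp_findSecond (hσ : Setup n a S σ) (ha : a + n * (n + 1) ≤ S) (hW : S + 3 * (n + 1) ≤ W)
    (hH : ∀ x y, y ∈ H.pref x) (hl : HoldsLists σ.mem a H.pref)
    (hf : ∀ x : Fin n, σ.mem (a + x * (n + 1)) = f x) (hf' : ∀ x, (H.pref x).idxOf (f x) = 0)
    (hmark : Holds (n := n) σ.mem S (fun y => if y ∈ Set.range f then 1 else 0))
    (hz : σ.mem (S + n) = 0) :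
    WP W findSecond (n * (6 * n + 18) + 4) (fun τ =>
      (∃ s, H.IsFirstSecond f s ∧
        Holds (n := n) τ.mem (S + (n + 1) + 1) (fun x => f x + s x)) ∧
      ∀ x, (x < S + (n + 1) ∨ S + 2 * (n + 1) ≤ x) → τ.mem x = σ.mem x) σ := by
  refine (WP.block_seq (k := n * (6 * n + 18) + 1) ?_ <| WP.while (k := 6 * n + 17) 20 rfl
    (fun m τ => ∃ i, m + i = n ∧ τ.reg 10 = i ∧ τ.reg 11 = a + i * (n + 1) ∧
    (∀ x : Fin n, x < i → ∃ y, ((y ∉ Set.range f ∧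
      ∀ z, (H.pref x).idxOf z < (H.pref x).idxOf y → z ∈ Set.range f) ∨
      (y = f x ∧ ∀ z, z ∈ Set.range f)) ∧ τ.mem (S + (n + 1) + 1 + x) = f x + y) ∧
    ∀ x, (x < S + (n + 1) ∨ S + 2 * (n + 1) ≤ x) → τ.mem x = σ.mem x) ?_ ?_ ?_).le ?_
  · simp
  · exact ⟨0, by omega, by simp, by simp [hσ.lists], fun x hx => absurd hx (by omega),
      fun x _ => by simp⟩
  · rintro m τ hτ ⟨i, hm, h10, h11, hmem, hout⟩ hc
    have hS := hσ.congr fun r hr => (hτ r hr).trans (execs_reg rfl σ r hr)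
    simp only [Test.Holds, h10, hS.size] at hc
    have hrow := row_add_le ⟨i, hc⟩
    have hfi : τ.mem (a + i * (n + 1)) = f ⟨i, hc⟩ := by
      rw [hout _ (by simp only at hrow; omega), ← hf]
    simp only at hrow
    refine ⟨m - 1, by omega, (WP.seq (k := 6 * n + 6) (l := 11) (WP.frame 10 rfl (wp_scanMarked hS
      ha hW hH (hl.congr (length_pref hH) fun x hx => hout x (by omega))
      (hmark.congr fun x _ hx => hout x (by omega))
      (by rw [hout _ (by omega), hz]) ⟨i, hc⟩ h11) ?_)).le (by omega)⟩
    rintro υ hυ ⟨hυm, hy⟩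
    have hS' := hS.congr fun r hr => hυ r (by omega)
    have h10' : υ.reg 10 = i := (hυ _ le_rfl).trans h10
    have h11' : υ.reg 11 = a + i * (n + 1) := (hυ _ (by omega)).trans h11
    refine (WP.block_seq (k := 9) (by simp) ?_).le (by simp)
    -- The second choice is in register `3` after a possible replacement of the word `n`.
    refine WP.seq (k := 3) (l := 6) (WP.mono (R := fun ω => ω.mem = τ.mem ∧
      ω.reg 12 = f ⟨i, hc⟩ ∧ ω.reg 10 = i ∧ ω.reg 11 = a + i * (n + 1) ∧ Setup n a S ω ∧
      ∃ y : Fin n, ω.reg 3 = y ∧ ((y ∉ Set.range f ∧ ∀ z, (H.pref ⟨i, hc⟩).idxOf z <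
        (H.pref ⟨i, hc⟩).idxOf y → z ∈ Set.range f) ∨
          (y = f ⟨i, hc⟩ ∧ ∀ z, z ∈ Set.range f))) (WP.ite ?_ ?_) ?_)
    · intro h
      simp [hS'.size] at h
      refine WP.block (by simp) ⟨by simp [hυm], by simp [hυm, h11', hfi], by simp [h10'],
        by simp [h11'], hS'.congr fun r hr => ?_, f ⟨i, hc⟩, by simp [hυm, h11', hfi],
        .inr ⟨rfl, ?_⟩⟩
      · exact (execs_reg (q := 20) (L := [.copy 3 12]) rfl _ r hr).trans
          (execs_reg (q := 20) (L := [.load 12 11]) rfl _ r hr)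
      · rcases hy with hy | ⟨y, hy, _⟩
        · exact hy.2
        · omega
    · intro h
      simp [hS'.size] at h
      refine (WP.block (by simp) ⟨by simp [hυm], by simp [hυm, h11', hfi], by simp [h10'],
        by simp [h11'], hS'.congr fun r hr => ?_, ?_⟩).le (by simp)
      · exact execs_reg (q := 20) (L := [.load 12 11]) rfl _ r hr
      · rcases hy with hy | ⟨y, hy, hy'⟩
        · exact absurd hy.1 h
        · exact ⟨y, by simp [hy], .inl hy'⟩
    · rintro ω ⟨hωm, h12, h10, h11, hS, y, h3, hy⟩
      have hy' := y.2
      have hf'' := (f ⟨i, hc⟩).2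
      refine (WP.block ?_ ⟨i + 1, by omega, ?_⟩).le le_rfl
      · simp [h3, h12, h10, h11, hS.one, hS.arr₂, hS.stride]
        omega
      · simp only [execs, exec_add, exec_store]
        simp [h3, h12, h10, h11, hS.one, hS.arr₂, hS.stride, Nat.succ_mul]
        refine ⟨by omega, fun x hx => ?_, fun x hx => ?_⟩
        · rcases hx.lt_or_eq with hx | hx
          · rw [Function.update_of_ne (by omega), hωm]
            simpa using hmem x hx
          · obtain rfl : x = ⟨i, hc⟩ := Fin.ext hx
            refine ⟨y, by simpa using hy, ?_⟩
            rw [show S + (n + 1) + 1 + ((⟨i, hc⟩ : Fin n) : ℕ) = S + (n + 1) + (i + 1) by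
              dsimp only; omega, Function.update_self, add_comm]
        · rw [Function.update_of_ne (by omega), hωm, hout x (by omega)]
  · rintro m τ hτ ⟨i, hm, h10, h11, hmem, hout⟩ hc
    have hS := hσ.congr fun r hr => (hτ r hr).trans (execs_reg rfl σ r hr)
    simp only [Test.Holds, h10, hS.size] at hc
    choose s hs hs' using fun x : Fin n => hmem x (by omega)
    exact ⟨⟨s, ⟨hf', hs⟩, hs'⟩, hout⟩
  · simp
    omega

end RAM

/-! ### Finding a popular matching of a house allocation instance -/

namespace RAM

open TwoChoice

/-- The word for the occupant of a house: `0` if there is none, and `x + 1` for applicant `x`. -/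
def occWord {n : ℕ} (o : Option (Fin n)) : ℕ := o.elim 0 fun x => x + 1

theorem occWord_pos {n : ℕ} {o : Option (Fin n)} : 0 < occWord o ↔ ∃ x, o = some x := by
  cases o <;> simp [occWord]

/-- Follow the walk from the house in register `13` for `n` moves. Registers `1` and `2` hold the
current house and the word for its occupant, and register `3` counts down; the occupant of the
house reached is left in register `2`. -/
def walk : Prog :=
  .seq (block [.copy 1 13, .add 0 26 1, .load 2 0, .copy 3 21])
    (.while (.lt 27 3)
      (.seq (.ite (.lt 27 2)
          (block [.add 4 25 2, .load 4 4, .sub 1 4 1, .add 0 26 1, .load 2 0]) (block []))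
        (block [.sub 3 3 20])))

variable {W n a S : ℕ} {σ : State} {f s : Fin n → Fin n} {occ : Fin n → Option (Fin n)}

/-- As the sum of the options of `x` is stored, the other option is found by a subtraction. -/
theorem add_sub_eq_other {x y : Fin n} (h : y = f x ∨ y = s x) :
    (f x + s x - y : ℕ) = other f s x y := by
  unfold other
  split_ifs with h1
  · rw [h1]
    omega
  · rw [h.resolve_left h1]
    omega

theorem wp_walk (hσ : Setup n a S σ) (hW : S + 3 * (n + 1) ≤ W)
    (hsum : Holds (n := n) σ.mem (S + (n + 1) + 1) (fun x => f x + s x))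
    (hocc : Holds σ.mem (S + 2 * (n + 1)) (fun y => occWord (occ y)))
    (hopt : ∀ {y x}, occ y = some x → y = f x ∨ y = s x) {y : Fin n} (hy : σ.reg 13 = y) :
    WP W walk (10 * n + 6) (fun τ => τ.mem = σ.mem ∧
      τ.reg 2 = occWord (occ ((move f s occ)^[n] y))) σ := by
  refine (WP.block_seq (k := n * 10 + 1) ?_ <| WP.while (k := 9) 20 rfl
    (fun m τ => ∃ t, m + t = n ∧ τ.mem = σ.mem ∧ τ.reg 3 = m ∧
      τ.reg 1 = (move f s occ)^[t] y ∧ τ.reg 2 = occWord (occ ((move f s occ)^[t] y)))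
    ?_ ?_ ?_).le ?_
  · simp [hy, hσ.arr₃]
    omega
  · exact ⟨0, rfl, rfl, by simp [hσ.size], by simp [hy], by simpa [hy, hσ.arr₃] using hocc y⟩
  · rintro m τ hτ ⟨t, hm, hmem, h3, h1, h2⟩ hc
    have hS := hσ.congr fun r hr => (hτ r hr).trans (execs_reg rfl σ r hr)
    simp only [Test.Holds, hS.zero, h3] at hc
    refine ⟨m - 1, by omega, WP.seq (k := 7) (l := 2) (WP.mono (R := fun υ => υ.mem = σ.mem ∧
      υ.reg 3 = m ∧ υ.reg 20 = 1 ∧ υ.reg 1 = (move f s occ)^[t + 1] y ∧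
      υ.reg 2 = occWord (occ ((move f s occ)^[t + 1] y))) (WP.ite (k := 6) ?_ ?_) ?_)⟩
    · intro h
      simp only [Test.Holds, hS.zero, h2] at h
      obtain ⟨x, hx⟩ := occWord_pos.1 h
      rw [hx] at h2
      change τ.reg 2 = x + 1 at h2
      have hsx : σ.mem (S + (n + 1) + (x + 1)) = f x + s x := by
        rw [show S + (n + 1) + ((x : ℕ) + 1) = S + (n + 1) + 1 + x by omega]
        exact hsum x
      have hmove : move f s occ ((move f s occ)^[t] y) =
          other f s x ((move f s occ)^[t] y) := by
        simp [move, hx]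
      have hoth := add_sub_eq_other (hopt hx)
      have hlt := (other f s x ((move f s occ)^[t] y)).2
      refine WP.block ?_ ?_
      · simp [h1, h2, hmem, hS.arr₂, hS.arr₃, hsx, hoth]
        omega
      · rw [Function.iterate_succ_apply', hmove]
        simp [h1, h2, h3, hmem, hS.arr₂, hS.arr₃, hS.one, hsx, hoth]
        exact hocc _
    · intro h
      have hx : occ ((move f s occ)^[t] y) = none := by
        simp only [Test.Holds, hS.zero, h2, occWord_pos] at h
        exact Option.eq_none_iff_forall_ne_some.2 fun x hx => h ⟨x, hx⟩
      have hmove : move f s occ ((move f s occ)^[t] y) = (move f s occ)^[t] y := by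
        rw [move.eq_def, hx]
      refine (WP.block (by simp) ?_).le (by simp)
      rw [Function.iterate_succ_apply', hmove]
      exact ⟨hmem, h3, hS.one, h1, h2⟩
    · rintro υ ⟨hmem, h3, h20, h1, h2⟩
      exact WP.block (by simp) ⟨t + 1, by omega, by simp [hmem], by simp [h3, h20], by simp [h1],
        by simp [h2]⟩
  · rintro m τ hτ ⟨t, hm, hmem, h3, h1, h2⟩ hc
    have hS := hσ.congr fun r hr => (hτ r hr).trans (execs_reg rfl σ r hr)
    simp only [Test.Holds, hS.zero, h3] at hc
    obtain rfl : t = n := by omega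
    exact ⟨hmem, h2⟩
  · simp
    omega

/-- Assign the house in register `13` to the applicant in register `10` (counted from `1`), and let
each evicted applicant take its other option. -/
def displace : Prog :=
  .seq (block [.copy 5 10, .copy 1 13, .add 0 26 1, .load 2 0])
    (.seq (.while (.lt 27 2)
        (block [.store 0 5, .copy 5 2, .add 4 25 5, .load 4 4, .sub 1 4 1, .add 0 26 1, .load 2 0]))
      (block [.store 0 5]))

/-- The evictions follow the walk that has been found to lead to a free house: an eviction changes
the occupant of a house that the rest of the walk avoids, so the distance `m` serves as a bound for
the number of further rounds. In the invariant, `x'` is the applicant to be assigned, with `y'` as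
the house it takes next, and `T'` are the other applicants. -/
theorem wp_displace (hσ : Setup n a S σ) (hW : S + 3 * (n + 1) ≤ W)
    (hsum : Holds (n := n) σ.mem (S + (n + 1) + 1) (fun x => f x + s x))
    (hocc : Holds σ.mem (S + 2 * (n + 1)) (fun y => occWord (occ y))) {T : Set (Fin n)}
    (hT : Assigns f s occ T) {x y : Fin n} (hx : x ∉ T) (hxy : y = f x ∨ y = s x)
    (hy : σ.reg 13 = y) (h10 : σ.reg 10 = x + 1) (hfree : ∃ t, Dist f s occ y t) :
    WP W displace (9 * n + 8) (fun τ => ∃ occ' : Fin n → Option (Fin n),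
      Assigns f s occ' (insert x T) ∧
      Holds τ.mem (S + 2 * (n + 1)) (fun y => occWord (occ' y)) ∧
      ∀ x, (x < S + 2 * (n + 1) ∨ S + 3 * (n + 1) ≤ x) → τ.mem x = σ.mem x) σ := by
  obtain ⟨t, ht⟩ := hfree
  have htn := ht.lt_card
  rw [Fintype.card_fin] at htn
  refine (WP.block_seq (k := t * 9 + 1 + 2) ?_ <| WP.seq <| WP.while (m := t) (k := 8) 20 rfl
    (fun m τ => ∃ (occ' : Fin n → Option (Fin n)) (T' : Set (Fin n)) (x' y' : Fin n),
      Dist f s occ' y' m ∧ Assigns f s occ' T' ∧ x' ∉ T' ∧ insert x' T' = insert x T ∧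
      (y' = f x' ∨ y' = s x') ∧ τ.reg 5 = x' + 1 ∧ τ.reg 1 = y' ∧
      τ.reg 0 = S + 2 * (n + 1) + y' ∧ τ.reg 2 = occWord (occ' y') ∧
      Holds τ.mem (S + 2 * (n + 1)) (fun y => occWord (occ' y)) ∧
      ∀ x, (x < S + 2 * (n + 1) ∨ S + 3 * (n + 1) ≤ x) → τ.mem x = σ.mem x)
    ?_ ?_ ?_).le ?_
  · simp [hy, hσ.arr₃]
    omega
  · exact ⟨occ, T, x, y, ht, hT, hx, rfl, hxy, by simp [h10], by simp [hy], by simp [hy, hσ.arr₃],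
      by simpa [hy, hσ.arr₃] using hocc y, by simpa using hocc, by simp⟩
  · rintro m τ hτ ⟨occ', T', x', y', hdist, hT', hx', hins, hxy', h5, h1, h0, h2, hmem, hout⟩ hc
    have hS := hσ.congr fun r hr => (hτ r hr).trans (execs_reg rfl σ r hr)
    simp only [Test.Holds, hS.zero, h2] at hc
    obtain ⟨z, hz⟩ := occWord_pos.1 hc
    cases hdist with
    | free h => rw [hz] at h; cases h
    | @step _ z' m' h hdist =>
      obtain rfl : z = z' := Option.some.inj (hz.symm.trans h)
      have hopt := (hT'.option hz)
      rw [hz] at h2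
      change τ.reg 2 = z + 1 at h2
      have hsz : τ.mem (S + (n + 1) + (z + 1)) = f z + s z := by
        rw [hout _ (by omega), show S + (n + 1) + ((z : ℕ) + 1) = S + (n + 1) + 1 + z by omega]
        exact hsum z
      have hoth := add_sub_eq_other hopt.2
      have hlt := (other f s z y').2
      have hne : S + (n + 1) + (z + 1) ≠ S + 2 * (n + 1) + (y' : ℕ) := by omega
      have hmem' := hmem.update y' (v := x' + 1)
      have hmem'' : Holds (Function.update τ.mem (S + 2 * (n + 1) + y') (x' + 1))
          (S + 2 * (n + 1)) (fun y => occWord (Function.update occ' y' (some x') y)) := by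
        convert hmem' using 1
        exact Function.comp_update occWord occ' y' (some x')
      have hw := hmem'' (other f s z y')
      refine ⟨m', rfl, WP.block ?_ ⟨Function.update occ' y' (some x'),
        {w | (w = x' ∨ w ∈ T') ∧ occ' y' ≠ some w}, z, other f s z y',
        hdist.update (.step hz hdist) (by omega) _, hT'.update hx' hxy', ?_, ?_,
        other_eq z y', ?_⟩⟩
      · simp [h0, h1, h2, h5, hS.arr₂, hS.arr₃, Function.update_of_ne hne, hsz, hoth]
        omega
      · rintro ⟨_, h⟩
        exact h hz
      · rw [← hins]
        ext w
        simp only [Set.mem_insert_iff, Set.mem_ofPred_eq, hz, ne_eq, Option.some.injEq]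
        constructor
        · rintro (rfl | h)
          · exact .inr hopt.1
          · exact h.1
        · intro h
          by_cases hw : w = z
          · exact .inl hw
          · exact .inr ⟨h, fun h' => hw h'.symm⟩
      · simp only [execs, exec_add, exec_store, exec_copy, exec_load, exec_sub]
        simp [h0, h1, h2, h5, hS.arr₂, hS.arr₃, Function.update_of_ne hne, hsz, hoth]
        refine ⟨hw, hmem'', fun x hx => ?_⟩
        rw [Function.update_of_ne (by omega), hout x hx]
  · rintro m τ hτ ⟨occ', T', x', y', hdist, hT', hx', hins, hxy', h5, h1, h0, h2, hmem, hout⟩ hc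
    have hS := hσ.congr fun r hr => (hτ r hr).trans (execs_reg rfl σ r hr)
    simp only [Test.Holds, hS.zero, h2] at hc
    have hz : occ' y' = none := by
      rw [occWord_pos] at hc
      exact Option.eq_none_iff_forall_ne_some.2 fun x hx => hc ⟨x, hx⟩
    refine (WP.block (by simp) ⟨Function.update occ' y' (some x'), ?_, ?_, ?_⟩).le (by simp)
    · convert hT'.update hx' hxy' using 1
      rw [← hins]
      ext w
      simp [hz]
    · have hmem' := hmem.update y' (v := x' + 1)
      simp only [execs, exec_store, h0, h5]
      convert hmem' using 1
      exact Function.comp_update occWord occ' y' (some x')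
    · intro x hx
      simp only [execs, exec_store, h0, h5]
      rw [Function.update_of_ne (by omega), hout x hx]
  · simp
    omega

/-- Assign the applicants one by one. A new applicant takes its first choice if the walk from there
leads to a free house, and otherwise its second choice if the walk from there does. If neither does,
the program gives up, and ends the loop by setting register `10` to `n`. Register `14` tells whether
everybody has been assigned. -/
def insertAll : Prog :=
  .seq (block [.const 10 0, .copy 11 23, .const 14 1])
    (.while (.lt 10 21)
      (.seq (block [.load 12 11, .copy 13 12])
        (.seq walk
          (.seq (.ite (.lt 27 2)
              (.seq (block [.add 4 20 10, .add 4 25 4, .load 4 4, .sub 13 4 12]) walk) (block []))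
            (.seq (block [.add 11 11 22, .add 10 10 20])
              (.ite (.lt 27 2) (block [.const 14 0, .copy 10 21]) displace))))))

/-- After following the walk for as many moves as there are houses, one is at a free house if and
only if the walk leads to one at all. -/
theorem exists_dist_iff_not_pos {y : Fin n} :
    (∃ t, Dist f s occ y t) ↔ ¬ 0 < occWord (occ ((move f s occ)^[n] y)) := by
  have h := exists_dist_iff (f := f) (s := s) (occ := occ) (y := y)
  rw [Fintype.card_fin] at h
  rw [h, occWord_pos]
  cases occ ((move f s occ)^[n] y) <;> simp

theorem wp_insertAll (hσ : Setup n a S σ) (ha : a + n * (n + 1) ≤ S) (hW : S + 3 * (n + 1) ≤ W)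
    (hf : ∀ x : Fin n, σ.mem (a + x * (n + 1)) = f x)
    (hsum : Holds (n := n) σ.mem (S + (n + 1) + 1) (fun x => f x + s x))
    (hz : ∀ x, S + 2 * (n + 1) ≤ x → x < S + 3 * (n + 1) → σ.mem x = 0) :
    WP W insertAll (n * (30 * n + 40) + 5) (fun τ =>
      ((τ.reg 14 = 1 ∧ ∃ e : Fin n ≃ Fin n, (∀ x, e x = f x ∨ e x = s x) ∧
          Holds (n := n) τ.mem (S + 2 * (n + 1)) (fun y => e.symm y + 1)) ∨
        (τ.reg 14 = 0 ∧ ¬ ∃ e : Fin n ≃ Fin n, ∀ x, e x = f x ∨ e x = s x)) ∧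
      ∀ x, (x < S + 2 * (n + 1) ∨ S + 3 * (n + 1) ≤ x) → τ.mem x = σ.mem x) σ := by
  refine (WP.block_seq (k := n * (30 * n + 40) + 1) ?_ <| WP.while (k := 30 * n + 39) 20 rfl
    (fun m τ => ((τ.reg 14 = 1 ∧ ∃ i, m + i = n ∧ τ.reg 10 = i ∧ τ.reg 11 = a + i * (n + 1) ∧
        ∃ occ, Assigns f s occ {x | (x : ℕ) < i} ∧
          Holds τ.mem (S + 2 * (n + 1)) (fun y => occWord (occ y))) ∨
      (τ.reg 14 = 0 ∧ τ.reg 10 = n ∧ ¬ ∃ e : Fin n ≃ Fin n, ∀ x, e x = f x ∨ e x = s x)) ∧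
      ∀ x, (x < S + 2 * (n + 1) ∨ S + 3 * (n + 1) ≤ x) → τ.mem x = σ.mem x) ?_ ?_ ?_).le ?_
  · simp
    omega
  · refine ⟨.inl ⟨by simp, 0, rfl, by simp, by simp [hσ.lists], fun _ => none, ?_, ?_⟩, by simp⟩
    · convert Assigns.empty (f := f) (s := s) using 1
      ext x
      simp
    · intro x
      simpa [occWord] using hz (S + 2 * (n + 1) + x) (by omega) (by omega)
  · rintro m τ hτ ⟨h, hout⟩ hc
    have hS := hσ.congr fun r hr => (hτ r hr).trans (execs_reg rfl σ r hr)
    obtain ⟨h14, i, hm, h10, h11, occ, hocc, hmem⟩ := h.resolve_right fun h => by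
      simp only [Test.Holds, hS.size, h.2.1, lt_irrefl] at hc
    simp only [Test.Holds, h10, hS.size] at hc
    let x : Fin n := ⟨i, hc⟩
    have hxi : (x : ℕ) = i := rfl
    have hrow := row_add_le x
    rw [hxi] at hrow
    have hxT : x ∉ {x : Fin n | (x : ℕ) < i} := lt_irrefl i
    have hins : {y : Fin n | (y : ℕ) < i + 1} = insert x {y : Fin n | (y : ℕ) < i} := by
      ext y
      simp only [Set.mem_insert_iff, Set.mem_ofPred_eq, Fin.ext_iff, hxi]
      omega
    have hfi : τ.mem (a + i * (n + 1)) = f x := by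
      rw [hout _ (by omega), ← hf, hxi]
    have hsum' : Holds (n := n) τ.mem (S + (n + 1) + 1) (fun x => f x + s x) :=
      hsum.congr fun y _ hy => hout y (by omega)
    have hsx : τ.mem (S + (n + 1) + (1 + i)) = f x + s x := by
      rw [show S + (n + 1) + (1 + i) = S + (n + 1) + 1 + x by omega]
      exact hsum' x
    have hopt := fun {y x} (h : occ y = some x) => (hocc.option h).2
    refine ⟨m - 1, by omega, (WP.block_seq (k := (10 * n + 6) + ((5 + (10 * n + 6) + 1) +
      (3 + (9 * n + 8 + 1)))) (by simp) ?_).le (by simp; omega)⟩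
    have hS₁ : Setup n a S (execs [.load 12 11, .copy 13 12] τ) :=
      hS.congr (execs_reg rfl τ)
    refine WP.seq (WP.frame 10 rfl (wp_walk hS₁ hW hsum' hmem hopt (y := f x) ?_) ?_)
    · simp [h11, hfi]
    rintro υ hυ ⟨hυm, h2⟩
    have hS₂ := hS₁.congr fun r hr => hυ r (by omega)
    have hυ10 : υ.reg 10 = i := (hυ _ le_rfl).trans h10
    have hυ11 : υ.reg 11 = a + i * (n + 1) := (hυ _ (by omega)).trans h11
    have hυ12 : υ.reg 12 = f x := (hυ _ (by omega)).trans (by simp [h11, hfi])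
    have hυ13 : υ.reg 13 = f x := (hυ _ (by omega)).trans (by simp [h11, hfi])
    have hυ14 : υ.reg 14 = 1 := (hυ _ (by omega)).trans h14
    change υ.mem = τ.mem at hυm
    -- The house in register `13` leads to a free one, unless neither option does.
    refine WP.seq (WP.mono (R := fun ω => ω.mem = τ.mem ∧ Setup n a S ω ∧ ω.reg 10 = i ∧
      ω.reg 11 = a + i * (n + 1) ∧ ω.reg 14 = 1 ∧ ∃ y, (y = f x ∨ y = s x) ∧ ω.reg 13 = y ∧
      (ω.reg 2 = 0 → ∃ t, Dist f s occ y t) ∧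
      (0 < ω.reg 2 → (¬ ∃ t, Dist f s occ (f x) t) ∧ ¬ ∃ t, Dist f s occ (s x) t))
      (WP.ite ?_ ?_) ?_)
    · intro hpos
      simp only [Test.Holds, hS₂.zero, h2] at hpos
      have hS₃ : Setup n a S (execs [.add 4 20 10, .add 4 25 4, .load 4 4, .sub 13 4 12] υ) :=
        hS₂.congr (execs_reg rfl υ)
      have hmem₃ : (execs [.add 4 20 10, .add 4 25 4, .load 4 4, .sub 13 4 12] υ).mem = τ.mem := by
        simp [hυm]
      have h13₃ : (execs [.add 4 20 10, .add 4 25 4, .load 4 4, .sub 13 4 12] υ).reg 13 = s x := by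
        simp [hυm, hυ10, hυ12, hS₂.one, hS₂.arr₂, hsx]
      refine WP.block_seq (k := 10 * n + 6) ?_ (WP.frame 10 rfl (wp_walk (occ := occ) hS₃ hW
        (by rwa [hmem₃]) (by rwa [hmem₃]) hopt h13₃) ?_)
      · simp [hυ10, hS₂.one, hS₂.arr₂]
        omega
      · rintro ω hω ⟨hωm, hω2⟩
        refine ⟨hωm.trans hmem₃, hS₃.congr fun r hr => hω r (by omega),
          (hω _ le_rfl).trans (by simp [hυ10]), (hω _ (by omega)).trans (by simp [hυ11]),
          (hω _ (by omega)).trans (by simp [hυ14]), s x, .inr rfl, (hω _ (by omega)).trans h13₃,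
          fun h => ?_, fun h => ?_⟩
        · exact exists_dist_iff_not_pos.2 (by omega)
        · exact ⟨fun h' => exists_dist_iff_not_pos.1 h' hpos,
            fun h' => exists_dist_iff_not_pos.1 h' (by omega)⟩
    · intro hpos
      simp only [Test.Holds, hS₂.zero, h2] at hpos
      exact (WP.block (by simp) ⟨hυm, hS₂, hυ10, hυ11, hυ14, f x, .inl rfl, hυ13,
        fun _ => exists_dist_iff_not_pos.2 hpos,
        fun h => absurd (show 0 < υ.reg 2 from h) (by omega)⟩).le (by simp; omega)
    · rintro ω ⟨hωm, hS₄, hω10, hω11, hω14, y, hy, hω13, hfree, hbad⟩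
      have hS₅ : Setup n a S (execs [.add 11 11 22, .add 10 10 20] ω) :=
        hS₄.congr (execs_reg rfl ω)
      have hmem₅ : (execs [.add 11 11 22, .add 10 10 20] ω).mem = τ.mem := by simp [hωm]
      have hreg₅ : (execs [.add 11 11 22, .add 10 10 20] ω).reg 2 = ω.reg 2 := by simp
      refine WP.block_seq (k := 9 * n + 8 + 1) ?_ (WP.ite ?_ ?_)
      · simp [hω10, hω11, hS₄.one, hS₄.stride]
        omega
      · intro hpos
        simp only [Test.Holds, hS₅.zero, hreg₅] at hpos
        have hbad' := hbad hpos
        refine (WP.block (by simp) ⟨.inr ⟨by simp, by simp [hS₄.size], ?_⟩, ?_⟩).le (by simp)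
        · rintro ⟨e, he⟩
          exact hocc.not_exists_injective hxT hbad'.1 hbad'.2 ⟨e, e.injective, he⟩
        · intro z hz'
          exact (congrFun hmem₅ z).trans (hout z hz')
      · intro hpos
        simp only [Test.Holds, hS₅.zero, hreg₅] at hpos
        refine WP.frame 10 rfl (wp_displace hS₅ hW (by rwa [hmem₅]) (by rwa [hmem₅]) hocc hxT hy
          (by simp [hω13]) (by simp [hω10, hS₄.one, hxi]) (hfree (by omega))) ?_
        rintro κ hκ ⟨occ', hocc', hmem', hout'⟩
        refine ⟨.inl ⟨(hκ _ (by omega)).trans (by simp [hω14]), i + 1, by omega,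
          (hκ _ (by omega)).trans (by simp [hω10, hS₄.one]),
          (hκ _ (by omega)).trans (by simp [hω11, hS₄.stride, Nat.succ_mul, add_assoc]), occ', ?_,
          hmem'⟩, fun z hz' => ?_⟩
        · rwa [hins]
        · rw [hout' z hz', hmem₅, hout z hz']
  · rintro m τ hτ ⟨h, hout⟩ hc
    have hS := hσ.congr fun r hr => (hτ r hr).trans (execs_reg rfl σ r hr)
    refine ⟨?_, hout⟩
    rcases h with ⟨h14, i, hm, h10, h11, occ, hocc, hmem⟩ | ⟨h14, _, h⟩
    · simp only [Test.Holds, h10, hS.size] at hc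
      have huniv : {x : Fin n | (x : ℕ) < i} = Set.univ := by
        ext x
        simp only [Set.mem_ofPred_eq, Set.mem_univ, iff_true]
        omega
      rw [huniv] at hocc
      obtain ⟨e, he, he'⟩ := hocc.exists_equiv rfl
      refine .inl ⟨h14, e, he', fun y => ?_⟩
      rw [hmem y]
      simp [he, occWord]
    · exact .inr ⟨h14, h⟩
  · simp
    omega

/-- Find a popular matching of a house allocation instance. -/
def solve : Prog := .seq markFirst (.seq findSecond insertAll)

theorem wp_solve {H : HouseAllocation (Fin n) (Fin n)} (hH : ∀ x y, y ∈ H.pref x)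
    (hσ : Setup n a S σ) (ha : a + n * (n + 1) ≤ S) (hW : S + 3 * (n + 1) ≤ W)
    (hl : HoldsLists σ.mem a H.pref)
    (hz : ∀ x, S ≤ x → x < S + 3 * (n + 1) → σ.mem x = 0) :
    WP W solve (n * (36 * n + 65) + 13) (fun τ =>
      ((τ.reg 14 = 1 ∧ ∃ e : Fin n ≃ Fin n, H.EnvyFirst e ∧
          Holds (n := n) τ.mem (S + 2 * (n + 1)) (fun y => e.symm y + 1)) ∨
        (τ.reg 14 = 0 ∧ ¬ ∃ e : Fin n ≃ Fin n, H.EnvyFirst e)) ∧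
      ∀ x, (x < S ∨ S + 3 * (n + 1) ≤ x) → τ.mem x = σ.mem x) σ := by
  have hlen := length_pref hH
  have hpos : ∀ x : Fin n, 0 < (H.pref x).length := fun x => by
    rw [hlen]
    exact x.pos
  let f : Fin n → Fin n := fun x => (H.pref x)[0]'(hpos x)
  have hf : ∀ x : Fin n, σ.mem (a + x * (n + 1)) = f x := fun x => (hl x).2 0 (hpos x)
  have hf' : ∀ x, (H.pref x).idxOf (f x) = 0 := fun x => (H.nodup x).idxOf_getElem 0 (hpos x)
  have hlt : ∀ {x : Fin n}, a + x * (n + 1) < S := fun {x} => by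
    have := row_add_le x
    omega
  refine (WP.seq (WP.frame 20 rfl (wp_markFirst hσ ha hW hf hz) ?_)).le
    (l := n * (36 * n + 65) + 13) (k := (7 * n + 4) + ((n * (6 * n + 18) + 4) +
      (n * (30 * n + 40) + 5))) ?_
  · rintro τ hτ ⟨hmark, hout⟩
    have hS := hσ.congr hτ
    refine WP.seq (WP.frame 20 rfl (wp_findSecond hS ha hW hH
      (hl.congr hlen fun x hx => hout x (by omega)) (fun x => ?_) hf' hmark ?_) ?_)
    · rw [hout _ (.inl hlt), hf]
    · rw [hout _ (by omega), hz _ (by omega) (by omega)]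
    rintro υ hυ ⟨⟨s, hs, hsum⟩, hout'⟩
    refine WP.mono (wp_insertAll (hS.congr hυ) ha hW (fun x => ?_) hsum fun x h1 h2 => ?_) ?_
    · have := hlt (x := x)
      rw [hout' _ (by omega), hout _ (by omega), hf]
    · rw [hout' _ (by omega), hout _ (by omega), hz _ (by omega) h2]
    · rintro ω ⟨h, hout''⟩
      simp only [hs.envyFirst_iff hH]
      exact ⟨h, fun x hx => by
        rw [hout'' _ (by omega), hout' _ (by omega), hout _ (by omega)]⟩
  · have h1 : n * (36 * n + 65) = n * (6 * n + 18) + n * (30 * n + 40) + 7 * n := by ring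
    omega

end RAM

/-! ### Deciding popularity in a house allocation instance -/

namespace RAM

variable {W n a S : ℕ} {σ : State} {H : HouseAllocation (Fin n) (Fin n)} {f : Fin n → Fin n}
  {e : Fin n ≃ Fin n}

/-- With the houses of the applicants in the first array, mark in the second array the houses that
are the first choices of their holders. -/
def markGood : Prog :=
  .seq (block [.const 10 0, .copy 11 23])
    (.while (.lt 10 21)
      (.seq (block [.load 12 11, .add 0 24 10, .load 1 0])
        (.seq (.ite (.eq 12 1) (block [.add 0 25 1, .store 0 20]) (block []))
          (block [.add 11 11 22, .add 10 10 20]))))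

theorem wp_markGood (hσ : Setup n a S σ) (ha : a + n * (n + 1) ≤ S) (hW : S + 3 * (n + 1) ≤ W)
    (hf : ∀ x : Fin n, σ.mem (a + x * (n + 1)) = f x)
    (he : Holds (n := n) σ.mem S (fun x => e x))
    (hz : ∀ x, S + (n + 1) ≤ x → x < S + 2 * (n + 1) → σ.mem x = 0) :
    WP W markGood (12 * n + 4) (fun τ =>
      Holds (n := n) τ.mem (S + (n + 1)) (fun y => if f (e.symm y) = y then 1 else 0) ∧
      ∀ x, (x < S + (n + 1) ∨ S + 2 * (n + 1) ≤ x) → τ.mem x = σ.mem x) σ := by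
  refine (WP.block_seq (k := n * 12 + 1) ?_ <| WP.while (k := 11) 20 rfl (fun m τ => ∃ i,
    m + i = n ∧ τ.reg 10 = i ∧ τ.reg 11 = a + i * (n + 1) ∧
    Holds (n := n) τ.mem (S + (n + 1))
      (fun y => if (e.symm y : ℕ) < i ∧ f (e.symm y) = y then 1 else 0) ∧
    ∀ x, (x < S + (n + 1) ∨ S + 2 * (n + 1) ≤ x) → τ.mem x = σ.mem x) ?_ ?_ ?_).le ?_
  · simp
  · refine ⟨0, by omega, by simp, by simp [hσ.lists], fun x => ?_, by simp⟩
    simpa using hz (S + (n + 1) + x) (by omega) (by omega)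
  · rintro m τ hτ ⟨i, hm, h10, h11, hmem, hout⟩ hc
    have hS := hσ.congr fun r hr => (hτ r hr).trans (execs_reg rfl σ r hr)
    simp only [Test.Holds, h10, hS.size] at hc
    let x : Fin n := ⟨i, hc⟩
    have hxi : (x : ℕ) = i := rfl
    have hrow := row_add_le x
    rw [hxi] at hrow
    have hfi : τ.mem (a + i * (n + 1)) = f x := by
      rw [hout _ (by omega), ← hf, hxi]
    have hex : τ.mem (S + i) = e x := by
      rw [hout _ (by omega), ← hxi]
      exact he x
    have hlt := (e x).2
    refine ⟨m - 1, by omega, WP.block_seq (k := 7) ?_ (WP.seq (k := 4) (l := 3) (WP.mono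
      (R := fun υ => Setup n a S υ ∧ υ.reg 10 = i ∧ υ.reg 11 = a + i * (n + 1) ∧
        Holds (n := n) υ.mem (S + (n + 1))
          (fun y => if (e.symm y : ℕ) < i + 1 ∧ f (e.symm y) = y then 1 else 0) ∧
        ∀ x, (x < S + (n + 1) ∨ S + 2 * (n + 1) ≤ x) → υ.mem x = σ.mem x)
      (WP.ite (k := 3) ?_ ?_) ?_))⟩
    · simp [h10, hS.arr₁]
      omega
    · intro h
      simp [h10, h11, hS.arr₁, hfi, hex, Fin.val_inj] at h
      refine WP.block ?_ ⟨hS.congr fun r hr => ?_, ?_⟩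
      · simp [h10, hS.arr₁, hS.arr₂, hex]
        omega
      · exact (execs_reg (q := 20) (L := [.add 0 25 1, .store 0 20]) rfl _ r hr).trans
          (execs_reg (q := 20) (L := [.load 12 11, .add 0 24 10, .load 1 0]) rfl _ r hr)
      · simp only [execs, exec_add, exec_store, exec_load]
        simp [h10, h11, hS.arr₁, hS.arr₂, hS.one, hex]
        refine ⟨?_, fun z hz => ?_⟩
        · convert hmem.update (e x) (v := 1) using 1
          funext y
          by_cases hy : y = e x
          · rw [hy, Function.update_self, if_pos ⟨by simp [hxi], by simp [h]⟩]
          · rw [Function.update_of_ne hy]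
            have hyi : (e.symm y : ℕ) ≠ i := fun h' =>
              hy ((Equiv.symm_apply_eq e).1 (Fin.ext h'))
            congr 2
            exact propext ⟨fun h' => by omega, fun h' => by omega⟩
        · rw [Function.update_of_ne (by omega), hout z (by omega)]
    · intro h
      simp [h10, h11, hS.arr₁, hfi, hex, Fin.val_inj] at h
      refine (WP.block (by simp) ⟨hS.congr fun r hr => ?_, by simp [h10], by simp [h11], ?_,
        by simpa using hout⟩).le (by simp)
      · exact execs_reg (q := 20) (L := [.load 12 11, .add 0 24 10, .load 1 0]) rfl _ r hr
      · simp only [execs, exec_add, exec_load]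
        convert hmem using 2 with y
        congr 1
        refine propext ⟨fun h' => ⟨lt_of_le_of_ne (Nat.lt_succ_iff.1 h'.1) fun h'' => h ?_, h'.2⟩,
          fun h' => ⟨by omega, h'.2⟩⟩
        have hxy : e.symm y = x := Fin.ext h''
        rw [← hxy, h'.2, Equiv.apply_symm_apply]
    · rintro υ ⟨hS', h10', h11', hmem', hout'⟩
      refine WP.block ?_ ⟨i + 1, by omega, by simp [h10', hS'.one],
        by simp [h11', hS'.stride, Nat.succ_mul, add_assoc], by simpa using hmem',
        by simpa using hout'⟩
      simp [h10', h11', hS'.one, hS'.stride]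
      omega
  · rintro m τ hτ ⟨i, hm, h10, h11, hmem, hout⟩ hc
    have hS := hσ.congr fun r hr => (hτ r hr).trans (execs_reg rfl σ r hr)
    simp only [Test.Holds, h10, hS.size] at hc
    refine ⟨?_, hout⟩
    convert hmem using 3 with y
    exact ⟨fun h => ⟨by omega, h⟩, fun h => h.2⟩
  · simp
    omega

/-- Go down the list of the applicant in register `10` to its house, and clear register `7` if one
of the houses passed is not marked. Register `5`, a sum of two truncated differences, is zero
exactly if the house is reached. -/
def scanToHouse : Prog :=
  .seq (block [.add 0 24 10, .load 4 0, .copy 1 11, .load 3 1, .sub 5 3 4, .sub 6 4 3, .add 5 5 6])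
    (.while (.lt 27 5)
      (.seq (block [.add 0 25 3, .load 2 0])
        (.seq (.ite (.lt 27 2) (block []) (block [.const 7 0]))
          (block [.add 1 1 20, .load 3 1, .sub 5 3 4, .sub 6 4 3, .add 5 5 6]))))

open Classical in
theorem wp_scanToHouse (hσ : Setup n a S σ) (ha : a + n * (n + 1) ≤ S) (hW : S + 3 * (n + 1) ≤ W)
    (hH : ∀ x y, y ∈ H.pref x) (hl : HoldsLists σ.mem a H.pref)
    (he : Holds (n := n) σ.mem S (fun x => e x)) {g : Fin n → Prop}
    (hg : Holds (n := n) σ.mem (S + (n + 1)) (fun y => if g y then 1 else 0))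
    {x : Fin n} (h10 : σ.reg 10 = x) (h11 : σ.reg 11 = a + x * (n + 1)) :
    WP W scanToHouse (13 * n + 9) (fun τ => τ.mem = σ.mem ∧
      τ.reg 7 = if ∀ y, (H.pref x).idxOf y < (H.pref x).idxOf (e x) → g y then σ.reg 7 else 0)
      σ := by
  have hrow := row_add_le x
  have hlen := length_pref hH x
  have hd := List.idxOf_lt_length_of_mem (hH x (e x))
  rw [hlen] at hd
  have hex : σ.mem (S + x) = e x := he x
  have hlt := (e x).2
  have hget : ∀ {j : ℕ} (hj : j < n), σ.mem (a + x * (n + 1) + j) =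
      (H.pref x)[j]'(by rwa [hlen]) := fun hj => (hl x).2 _ (by rwa [hlen])
  have hget0 := hget (Nat.zero_lt_of_lt hd)
  rw [add_zero] at hget0
  have hlt' : ∀ {j : ℕ} (hj : j < n), ((H.pref x)[j]'(by rwa [hlen]) : ℕ) < n :=
    fun hj => Fin.is_lt _
  refine (WP.block_seq (k := (H.pref x).idxOf (e x) * 13 + 1) ?_ <| WP.while
    (m := (H.pref x).idxOf (e x)) (k := 12) 20 rfl
    (fun m τ => ∃ j, m + j = (H.pref x).idxOf (e x) ∧ τ.mem = σ.mem ∧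
      τ.reg 1 = a + x * (n + 1) + j ∧ τ.reg 3 = σ.mem (a + x * (n + 1) + j) ∧ τ.reg 4 = e x ∧
      τ.reg 5 = (τ.reg 3 - e x) + (e x - τ.reg 3) ∧
      τ.reg 7 = if ∀ y, (H.pref x).idxOf y < j → g y then σ.reg 7 else 0) ?_ ?_ ?_).le ?_
  · have := hlt' (Nat.zero_lt_of_lt hd)
    simp [h10, h11, hσ.arr₁, hex, hget0]
    omega
  · refine ⟨0, by omega, by simp, by simp [h11], by simp [h11], by simp [h10, hσ.arr₁, hex],
      by simp [h10, h11, hσ.arr₁, hex], by simp⟩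
  · rintro m τ hτ ⟨j, hm, hmem, h1, h3, h4, h5, h7⟩ hc
    have hS := hσ.congr fun r hr => (hτ r hr).trans (execs_reg rfl σ r hr)
    have hjn : j < n := by omega
    rw [hget hjn] at h3
    rw [h3] at h5
    simp only [Test.Holds, hS.zero, h5] at hc
    have hjd : j ≠ (H.pref x).idxOf (e x) := by
      rintro rfl
      simp at hc
    have hj1 : j + 1 < n := by omega
    have hgj := hg ((H.pref x)[j])
    have hltj := hlt' hjn
    refine ⟨m - 1, by omega, WP.block_seq (k := 9) ?_ (WP.seq (k := 3) (l := 6) (WP.mono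
      (R := fun υ => υ.mem = σ.mem ∧ Setup n a S υ ∧ υ.reg 1 = a + x * (n + 1) + j ∧
        υ.reg 4 = e x ∧ υ.reg 7 = if ∀ y, (H.pref x).idxOf y < j + 1 → g y then σ.reg 7 else 0)
      (WP.ite (k := 2) ?_ ?_) ?_))⟩
    · simp [h3, hS.arr₂]
      omega
    · intro h
      simp [h3, hS.arr₂, hS.zero, hmem, hgj] at h
      refine (WP.block (by simp) ⟨by simp [hmem], hS.congr fun r hr => ?_, by simp [h1],
        by simp [h4], ?_⟩).le (by simp)
      · exact execs_reg (q := 20) (L := [.add 0 25 3, .load 2 0]) rfl _ r hr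
      · simp [h7]
        congr 1
        refine propext ⟨fun h' y hy => ?_, fun h' y hy => h' y (by omega)⟩
        rcases hy.lt_or_eq with hy | hy
        · exact h' y hy
        · have : y = (H.pref x)[j] := by
            simp [← hy]
          rw [this]
          by_contra hne
          rw [if_neg hne] at h
          exact lt_irrefl _ h
    · intro h
      simp [h3, hS.arr₂, hS.zero, hmem, hgj] at h
      refine WP.block (by simp) ⟨by simp [hmem], hS.congr fun r hr => ?_, by simp [h1],
        by simp [h4], ?_⟩
      · exact (execs_reg (q := 20) (L := [.const 7 0]) rfl _ r hr).trans
          (execs_reg (q := 20) (L := [.add 0 25 3, .load 2 0]) rfl _ r hr)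
      · rw [if_neg]
        · simp
        · intro h'
          refine h (h' _ ?_)
          rw [(H.nodup x).idxOf_getElem]
          exact Nat.lt_succ_self j
    · rintro υ ⟨hυm, hS', h1', h4', h7'⟩
      have hget1 := hget hj1
      have hltj1 := hlt' hj1
      rw [← add_assoc] at hget1
      refine WP.block ?_ ⟨j + 1, by omega, by simp [hυm], by simp [h1', hS'.one, add_assoc],
        by simp [h1', hS'.one, hυm, ← add_assoc], by simp [h4'],
        by simp [h4'], by simp [h7']⟩
      simp [h1', h4', hS'.one, hυm, hget1]
      omega
  · rintro m τ hτ ⟨j, hm, hmem, h1, h3, h4, h5, h7⟩ hc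
    have hS := hσ.congr fun r hr => (hτ r hr).trans (execs_reg rfl σ r hr)
    have hjn : j < n := by omega
    rw [hget hjn] at h3
    rw [h3] at h5
    simp only [Test.Holds, hS.zero, h5] at hc
    have hj : (H.pref x)[j] = e x := Fin.ext (by omega)
    have hjd : j = (H.pref x).idxOf (e x) := by
      rw [← hj, (H.nodup x).idxOf_getElem]
    rw [hjd] at h7
    exact ⟨hmem, h7⟩
  · simp
    omega

/-- Check for every applicant that the houses it prefers to its own are marked. -/
def checkMarks : Prog :=
  .seq (block [.const 10 0, .copy 11 23, .const 7 1])
    (.while (.lt 10 21) (.seq scanToHouse (block [.add 11 11 22, .add 10 10 20])))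

open Classical in
theorem wp_checkMarks (hσ : Setup n a S σ) (ha : a + n * (n + 1) ≤ S) (hW : S + 3 * (n + 1) ≤ W)
    (hH : ∀ x y, y ∈ H.pref x) (hl : HoldsLists σ.mem a H.pref)
    (he : Holds (n := n) σ.mem S (fun x => e x)) {g : Fin n → Prop}
    (hg : Holds (n := n) σ.mem (S + (n + 1)) (fun y => if g y then 1 else 0)) :
    WP W checkMarks (n * (13 * n + 13) + 5) (fun τ => τ.mem = σ.mem ∧
      τ.reg 7 = if ∀ x y, (H.pref x).idxOf y < (H.pref x).idxOf (e x) → g y then 1 else 0) σ := by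
  refine (WP.block_seq (k := n * (13 * n + 13) + 1) ?_ <| WP.while (k := 13 * n + 12) 20 rfl
    (fun m τ => ∃ i, m + i = n ∧ τ.reg 10 = i ∧ τ.reg 11 = a + i * (n + 1) ∧ τ.mem = σ.mem ∧
      τ.reg 7 = if ∀ (x y : Fin n), (x : ℕ) < i → (H.pref x).idxOf y < (H.pref x).idxOf (e x) → g y
        then 1 else 0) ?_ ?_ ?_).le ?_
  · simp
    omega
  · exact ⟨0, by omega, by simp, by simp [hσ.lists], by simp, by simp⟩
  · rintro m τ hτ ⟨i, hm, h10, h11, hmem, h7⟩ hc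
    have hS := hσ.congr fun r hr => (hτ r hr).trans (execs_reg rfl σ r hr)
    simp only [Test.Holds, h10, hS.size] at hc
    let x : Fin n := ⟨i, hc⟩
    have hxi : (x : ℕ) = i := rfl
    have hrow := row_add_le x
    rw [hxi] at hrow
    refine ⟨m - 1, by omega, WP.seq (k := 13 * n + 9) (l := 3) (WP.frame 10 rfl
      (wp_scanToHouse (g := g) (x := x) hS ha hW hH (by rwa [hmem]) (by rwa [hmem]) (by rwa [hmem])
        h10 h11) ?_)⟩
    rintro υ hυ ⟨hυm, h7'⟩
    have hS' := hS.congr fun r hr => hυ r (by omega)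
    have h10' : υ.reg 10 = i := (hυ _ le_rfl).trans h10
    have h11' : υ.reg 11 = a + i * (n + 1) := (hυ _ (by omega)).trans h11
    refine WP.block ?_ ⟨i + 1, by omega, by simp [h10', hS'.one],
      by simp [h11', hS'.stride, Nat.succ_mul, add_assoc], by simp [hυm, hmem], ?_⟩
    · simp [h10', h11', hS'.one, hS'.stride]
      omega
    · have hiff : (∀ (x y : Fin n), (x : ℕ) < i + 1 →
            (H.pref x).idxOf y < (H.pref x).idxOf (e x) → g y) ↔
          (∀ y, (H.pref x).idxOf y < (H.pref x).idxOf (e x) → g y) ∧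
          ∀ (x y : Fin n), (x : ℕ) < i → (H.pref x).idxOf y < (H.pref x).idxOf (e x) → g y := by
        refine ⟨fun h => ⟨fun y => h x y (by omega), fun z y hz => h z y (by omega)⟩,
          fun h z y hz => ?_⟩
        rcases (Nat.lt_succ_iff.1 hz).lt_or_eq with hz | hz
        · exact h.2 z y hz
        · obtain rfl : z = x := Fin.ext hz
          exact h.1 y
      simp only [hiff, ite_and]
      rw [← h7, ← h7']
      simp
  · rintro m τ hτ ⟨i, hm, h10, h11, hmem, h7⟩ hc
    have hS := hσ.congr fun r hr => (hτ r hr).trans (execs_reg rfl σ r hr)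
    simp only [Test.Holds, h10, hS.size] at hc
    refine ⟨hmem, h7.trans ?_⟩
    congr 1
    exact propext ⟨fun h x y => h x y (by omega), fun h x y _ => h x y⟩
  · simp
    omega

/-- Decide whether the perfect matching in the first array is popular. -/
def verify : Prog := .seq markGood checkMarks

open Classical in
theorem wp_verify (hH : ∀ x y, y ∈ H.pref x) (hσ : Setup n a S σ) (ha : a + n * (n + 1) ≤ S)
    (hW : S + 3 * (n + 1) ≤ W) (hl : HoldsLists σ.mem a H.pref)
    (he : Holds (n := n) σ.mem S (fun x => e x))
    (hz : ∀ x, S + (n + 1) ≤ x → x < S + 2 * (n + 1) → σ.mem x = 0) :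
    WP W verify (n * (13 * n + 25) + 9) (fun τ =>
      τ.reg 7 = (if H.EnvyFirst e then 1 else 0) ∧
      ∀ x, (x < S ∨ S + 3 * (n + 1) ≤ x) → τ.mem x = σ.mem x) σ := by
  have hlen := length_pref hH
  have hpos : ∀ x : Fin n, 0 < (H.pref x).length := fun x => by
    rw [hlen]
    exact x.pos
  let f : Fin n → Fin n := fun x => (H.pref x)[0]'(hpos x)
  have hf : ∀ x : Fin n, σ.mem (a + x * (n + 1)) = f x := fun x => (hl x).2 0 (hpos x)
  have hf' : ∀ x, (H.pref x).idxOf (f x) = 0 := fun x => (H.nodup x).idxOf_getElem 0 (hpos x)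
  refine (WP.seq (WP.frame 20 rfl (wp_markGood hσ ha hW hf he hz) ?_)).le
    (l := n * (13 * n + 25) + 9) (k := (12 * n + 4) + (n * (13 * n + 13) + 5)) ?_
  · rintro τ hτ ⟨hgood, hout⟩
    refine WP.mono (wp_checkMarks (e := e) (g := fun y => f (e.symm y) = y) (hσ.congr hτ) ha hW hH
      (hl.congr hlen fun x hx => hout x (by omega)) (he.congr fun x _ hx => hout x (by omega))
      (by convert hgood using 3)) ?_
    rintro υ ⟨hυm, h7⟩
    refine ⟨h7.trans ?_, fun x hx => by rw [hυm, hout x (by omega)]⟩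
    congr 1
    have key : ∀ y, f (e.symm y) = y ↔ (H.pref (e.symm y)).idxOf y = 0 := fun y =>
      ⟨fun h => by rw [← hf' (e.symm y), h], fun h =>
        (List.idxOf_inj (hH _ _)).1 ((hf' _).trans h.symm)⟩
    simp only [HouseAllocation.EnvyFirst, key]
  · have h1 : n * (13 * n + 25) = n * (13 * n + 13) + 12 * n := by ring
    omega

end RAM

/-! ### The layout of the input -/

theorem List.getElem?_flatMap_of_length {α β : Type*} {g : α → List β} {d : ℕ}
    (hg : ∀ x, (g x).length = d) (l : List α) {i j : ℕ} (hi : i < l.length) (hj : j < d) :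
    (l.flatMap g)[i * d + j]? = (g l[i])[j]? := by
  induction l generalizing i with
  | nil => simp at hi
  | cons x l ih =>
    rw [List.flatMap_cons]
    cases i with
    | zero =>
      rw [zero_mul, zero_add, List.getElem?_append_left (by rwa [hg])]
      rfl
    | succ i =>
      have h1 : (i + 1) * d + j = (g x).length + (i * d + j) := by
        rw [hg, Nat.succ_mul]
        omega
      rw [h1, List.getElem?_append_right (Nat.le_add_right _ _), Nat.add_sub_cancel_left,
        ih (by simpa using hi)]
      rfl

theorem List.length_flatMap_of_length {α β : Type*} {g : α → List β} {d : ℕ}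
    (hg : ∀ x, (g x).length = d) (l : List α) : (l.flatMap g).length = l.length * d := by
  induction l with
  | nil => simp
  | cons x l ih =>
    rw [List.flatMap_cons, List.length_append, ih, hg, List.length_cons, Nat.succ_mul, add_comm]

namespace CyclicInstance

variable {n : ℕ} {pref : Fin n → List (Fin n)} {I : CyclicInstance n}

theorem encodeLists_eq (pref : Fin n → List (Fin n)) : encodeLists pref =
    (List.finRange n).flatMap fun x => (pref x).length :: (pref x).map Fin.val := by
  simp [encodeLists, List.map_eq_flatMap]

theorem length_encodeLists (hl : ∀ x, (pref x).length = n) :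
    (encodeLists pref).length = n * (n + 1) := by
  rw [encodeLists_eq, List.length_flatMap_of_length (d := n + 1) (by simp [hl]),
    List.length_finRange]

theorem getElem?_encodeLists (hl : ∀ x, (pref x).length = n) (x : Fin n) {j : ℕ} (hj : j < n + 1) :
    (encodeLists pref)[x * (n + 1) + j]? =
      ((pref x).length :: (pref x).map Fin.val)[j]? := by
  rw [encodeLists_eq, List.getElem?_flatMap_of_length (d := n + 1) (by simp [hl]) _ (by simp) hj]
  simp

theorem head?_encodeLists (hl : ∀ x, (pref x).length = n) (hn : 0 < n) (l : List ℕ) :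
    (encodeLists pref ++ l)[0]? = some n := by
  have h := getElem?_encodeLists hl ⟨0, hn⟩ (j := 0) (by omega)
  rw [List.getElem?_append_left (by rw [length_encodeLists hl]; positivity)]
  simpa [hl] using h

theorem le_of_mem_encodeLists (hl : ∀ x, (pref x).length = n) {v : ℕ}
    (hv : v ∈ encodeLists pref) : v ≤ n := by
  simp only [encodeLists_eq, List.mem_flatMap, List.mem_cons, List.mem_map] at hv
  obtain ⟨x, _, rfl | ⟨y, _, rfl⟩⟩ := hv
  · exact (hl x).le
  · exact y.2.le

theorem Complete.lengthA (hI : I.Complete) (x : Fin n) : (I.prefA x).length = n :=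
  RAM.length_pref (H := I.houseAB) hI.completeA x

theorem Complete.lengthB (hI : I.Complete) (x : Fin n) : (I.prefB x).length = n :=
  RAM.length_pref (H := I.houseBC) hI.completeB x

theorem Complete.lengthC (hI : I.Complete) (x : Fin n) : (I.prefC x).length = n :=
  RAM.length_pref (H := ⟨I.prefC, I.nodupC⟩) hI.completeC x

theorem Complete.length_encode (hI : I.Complete) : I.encode.length = 3 * (n * (n + 1)) + 1 := by
  simp only [encode, List.length_cons, List.length_append, length_encodeLists hI.lengthA,
    length_encodeLists hI.lengthB, length_encodeLists hI.lengthC]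
  omega

theorem Complete.le_of_mem_encode (hI : I.Complete) {v : ℕ} (hv : v ∈ I.encode) : v ≤ n := by
  simp only [encode, List.mem_cons, List.mem_append] at hv
  rcases hv with rfl | (h | h) | h
  · exact le_rfl
  · exact le_of_mem_encodeLists hI.lengthA h
  · exact le_of_mem_encodeLists hI.lengthB h
  · exact le_of_mem_encodeLists hI.lengthC h

end CyclicInstance

namespace RAM

open CyclicInstance

theorem init_mem_append (l l' : List ℕ) (i : ℕ) :
    (init (l ++ l')).mem (l.length + i) = (init l').mem i := by
  simp only [init, List.getD_eq_getElem?_getD]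
  rw [List.getElem?_append_right (Nat.le_add_right _ _), Nat.add_sub_cancel_left]

theorem init_mem_eq_zero {l : List ℕ} {i : ℕ} (h : l.length ≤ i) : (init l).mem i = 0 :=
  List.getD_eq_default _ _ h

variable {n W k K : ℕ} {I : CyclicInstance n}

theorem holdsLists_init {pref : Fin n → List (Fin n)} (hl : ∀ x, (pref x).length = n)
    (l l' : List ℕ) (hl' : 0 < n → l'[0]? = some n) :
    HoldsLists (init (l ++ (encodeLists pref ++ l'))).mem (l.length + 1) pref := by
  intro x
  have hrow := row_add_le x
  have hlen := length_encodeLists hl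
  refine ⟨?_, fun j hj => ?_⟩
  · rw [show l.length + 1 + x * (n + 1) + n = l.length + (x + 1 : ℕ) * (n + 1) by
      rw [Nat.succ_mul]; omega, init_mem_append]
    simp only [init, List.getD_eq_getElem?_getD]
    rcases Nat.lt_or_ge (x + 1) n with hx | hx
    · have h1 := row_add_le ⟨x + 1, hx⟩
      have h2 := getElem?_encodeLists hl ⟨x + 1, hx⟩ (j := 0) (by omega)
      simp only [add_zero] at h1 h2
      rw [List.getElem?_append_left (by omega), h2]
      simp [hl]
    · have h1 : (x : ℕ) + 1 = n := by omega
      rw [h1, List.getElem?_append_right hlen.le, hlen, Nat.sub_self, hl' x.pos]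
      rfl
  · rw [hl] at hj
    rw [show l.length + 1 + x * (n + 1) + j = l.length + (x * (n + 1) + (j + 1)) by omega,
      init_mem_append]
    simp only [init, List.getD_eq_getElem?_getD]
    rw [List.getElem?_append_left (by omega), getElem?_encodeLists hl x (by omega)]
    simp [hl, hj]

theorem holdsLists_houseAB (hI : I.Complete) (l : List ℕ) :
    HoldsLists (init (I.encode ++ l)).mem 2 I.houseAB.pref := by
  have h := holdsLists_init hI.lengthA [n]
    (encodeLists I.prefB ++ (encodeLists I.prefC ++ l)) fun hn =>
      head?_encodeLists hI.lengthB hn _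
  simpa [encode, houseAB] using h

theorem holdsLists_houseBC (hI : I.Complete) (l : List ℕ) :
    HoldsLists (init (I.encode ++ l)).mem (n * (n + 1) + 2) I.houseBC.pref := by
  have h := holdsLists_init hI.lengthB (n :: encodeLists I.prefA) (encodeLists I.prefC ++ l)
    fun hn => head?_encodeLists hI.lengthC hn _
  simpa [encode, houseBC, length_encodeLists hI.lengthA] using h

/-- The output is not fixed in advance, but only required to satisfy `P`. -/
theorem WP.outputsWithin {p : Prog} {input : List ℕ} {P : List ℕ → Prop}
    (h : WP (K * input.length) p k (fun τ => ∃ output, P output ∧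
      ∀ i (h : i < output.length), τ.mem i = output[i]) (init input))
    (hk : k ≤ K * input.length) (hb : ∀ v ∈ input, v ≤ K * input.length) :
    ∃ output, P output ∧ OutputsWithin p K input output := by
  obtain ⟨k', hk', τ, hr, -, output, hP, hτ⟩ := h ⟨fun _ => Nat.zero_le _, fun i => by
    rcases Nat.lt_or_ge i input.length with hi | hi
    · simp only [init, List.getD_eq_getElem _ _ hi]
      exact hb _ (List.getElem_mem hi)
    · rw [init_mem_eq_zero hi]
      exact Nat.zero_le _⟩
  exact ⟨output, hP, k', hk'.trans hk, τ, hr, hτ⟩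

/-! ### The main programs -/

/-- Set the registers `20`, `21`, `22`, `28` to `1`, `n`, `n + 1`, and `n * (n + 1)`. -/
def sizes : Prog :=
  .seq (block [.load 21 0, .const 20 1, .add 22 21 20])
    (.while (.lt 1 21) (block [.add 28 28 22, .add 1 1 20]))

theorem wp_sizes {σ : State} (hr : ∀ r, σ.reg r = 0) (hn : σ.mem 0 = n)
    (hW : n * (n + 1) + (n + 1) ≤ W) :
    WP W sizes (4 * n + 5) (fun τ => τ.mem = σ.mem ∧ τ.reg 20 = 1 ∧ τ.reg 21 = n ∧
      τ.reg 22 = n + 1 ∧ τ.reg 27 = 0 ∧ τ.reg 28 = n * (n + 1)) σ := by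
  refine (WP.block_seq (k := n * 4 + 1) ?_ <| WP.while (k := 3) 50 rfl (fun m τ => ∃ i, m + i = n ∧
    τ.mem = σ.mem ∧ τ.reg 20 = 1 ∧ τ.reg 21 = n ∧ τ.reg 22 = n + 1 ∧ τ.reg 27 = 0 ∧
    τ.reg 1 = i ∧ τ.reg 28 = i * (n + 1)) ?_ ?_ ?_).le ?_
  · simp [hr, hn]
    omega
  · exact ⟨0, by omega, by simp, by simp, by simp [hr, hn], by simp [hr, hn], by simp [hr],
      by simp [hr], by simp [hr]⟩
  · rintro m τ - ⟨i, hm, hmem, h20, h21, h22, h27, h1, h28⟩ hc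
    simp only [Test.Holds, h1, h21] at hc
    have hrow := row_add_le ⟨i, hc⟩
    simp only at hrow
    refine ⟨m - 1, by omega, WP.block ?_ ⟨i + 1, by omega, by simp [hmem], by simp [h20],
      by simp [h21], by simp [h22], by simp [h27], by simp [h1, h20],
      by simp [h28, h22, Nat.succ_mul]⟩⟩
    simp [h28, h22, h1, h20]
    omega
  · rintro m τ - ⟨i, hm, hmem, h20, h21, h22, h27, h1, h28⟩ hc
    simp only [Test.Holds, h1, h21] at hc
    obtain rfl : i = n := by omega
    exact ⟨hmem, h20, h21, h22, h27, h28⟩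
  · simp
    omega

end RAM

namespace RAM

open CyclicInstance HouseAllocation

variable {n W k K a S : ℕ} {I : CyclicInstance n} {σ : State} {e e₁ e₂ : Fin n ≃ Fin n}

/-- The triples of the composed matching, in the order of the agents in `C`. -/
def tripleList (e₁ e₂ : Fin n ≃ Fin n) : List (Triple n) :=
  (List.finRange n).map fun c => (e₁.symm (e₂.symm c), e₂.symm c, c)

theorem nodup_tripleList : (tripleList e₁ e₂).Nodup :=
  List.Nodup.map (fun _ _ h => congrArg (fun t : Triple n => t.2.2) h) (List.nodup_finRange n)

theorem length_tripleList : (tripleList e₁ e₂).length = n := by simp [tripleList]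

theorem toFinset_tripleList : (tripleList e₁ e₂).toFinset = triples e₁ e₂ := by
  ext ⟨a, b, c⟩
  simp only [tripleList, List.mem_toFinset, List.mem_map, List.mem_finRange, true_and,
    Prod.mk.injEq, mem_triples]
  constructor
  · rintro ⟨c, rfl, rfl, rfl⟩
    simp
  · rintro ⟨rfl, rfl⟩
    exact ⟨_, by simp, by simp, rfl⟩

theorem length_encodeTriples (L : List (Triple n)) :
    (encodeTriples L).length = 3 * L.length + 1 := by
  rw [encodeTriples, List.length_cons, List.length_flatMap_of_length (d := 3) (by simp)]
  omega

theorem getElem?_encodeTriples (L : List (Triple n)) {q r : ℕ} (hq : q < L.length) (hr : r < 3) :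
    (encodeTriples L)[1 + 3 * q + r]? =
      [(L[q].1 : ℕ), (L[q].2.1 : ℕ), (L[q].2.2 : ℕ)][r]? := by
  rw [encodeTriples, show 1 + 3 * q + r = (q * 3 + r) + 1 by omega, List.getElem?_cons_succ,
    List.getElem?_flatMap_of_length (d := 3) (by simp) _ hq hr]

theorem le_of_mem_encodeTriples {L : List (Triple n)} {v : ℕ} (hv : v ∈ encodeTriples L) :
    v ≤ n + L.length := by
  simp only [encodeTriples, List.mem_cons, List.mem_flatMap, List.not_mem_nil, or_false] at hv
  rcases hv with rfl | ⟨t, _, rfl | rfl | rfl⟩ <;> omega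

/-- Write the word `1` and the triples, given the holders of the houses in both instances. -/
def output : Prog :=
  .seq (block [.store 27 20, .store 20 21, .const 10 0, .const 11 2])
    (.while (.lt 10 21)
      (block [.add 0 26 10, .load 1 0, .sub 1 1 20, .add 0 29 1, .load 2 0, .sub 2 2 20,
        .store 11 2, .add 11 11 20, .store 11 1, .add 11 11 20, .store 11 10, .add 11 11 20,
        .add 10 10 20]))

theorem wp_output {O₁ O₂ : ℕ} (h20 : σ.reg 20 = 1) (h21 : σ.reg 21 = n) (h26 : σ.reg 26 = O₂)
    (h27 : σ.reg 27 = 0) (h29 : σ.reg 29 = O₁) (hO₁ : 3 * n + 2 ≤ O₁) (hO₂ : 3 * n + 2 ≤ O₂)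
    (hW₁ : O₁ + n ≤ W) (hW₂ : O₂ + n ≤ W)
    (he₁ : Holds (n := n) σ.mem O₁ (fun y => e₁.symm y + 1))
    (he₂ : Holds (n := n) σ.mem O₂ (fun y => e₂.symm y + 1)) :
    WP W output (15 * n + 6) (fun τ =>
      ∀ i (h : i < (1 :: encodeTriples (tripleList e₁ e₂)).length),
        τ.mem i = (1 :: encodeTriples (tripleList e₁ e₂))[i]) σ := by
  refine (WP.block_seq (k := n * 15 + 1) ?_ <| WP.while (k := 14) 50 rfl (fun m τ => ∃ i,
    m + i = n ∧ τ.reg 20 = 1 ∧ τ.reg 21 = n ∧ τ.reg 26 = O₂ ∧ τ.reg 29 = O₁ ∧ τ.reg 10 = i ∧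
    τ.reg 11 = 2 + 3 * i ∧ τ.mem 0 = 1 ∧ τ.mem 1 = n ∧
    (∀ c : Fin n, c < i → τ.mem (2 + 3 * c) = e₁.symm (e₂.symm c) ∧
      τ.mem (2 + 3 * c + 1) = e₂.symm c ∧ τ.mem (2 + 3 * c + 2) = c) ∧
    ∀ x, 3 * n + 2 ≤ x → τ.mem x = σ.mem x) ?_ ?_ ?_).le ?_
  · simp
    omega
  · refine ⟨0, by omega, by simp [h20], by simp [h21], by simp [h26], by simp [h29], by simp,
      by simp, by simp [h20, h27], by simp [h20, h21], fun c hc => absurd hc (by omega),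
      fun x hx => ?_⟩
    simp only [execs, exec_store, exec_const, h20, h27]
    rw [Function.update_of_ne (by omega), Function.update_of_ne (by omega)]
  · rintro m τ - ⟨i, hm, h20, h21, h26, h29, h10, h11, hm0, hm1, hmem, hout⟩ hc
    simp only [Test.Holds, h10, h21] at hc
    let c : Fin n := ⟨i, hc⟩
    have hci : (c : ℕ) = i := rfl
    have h1 : τ.mem (O₂ + i) = e₂.symm c + 1 := by
      rw [hout _ (by omega), ← hci]
      exact he₂ c
    have h2 : τ.mem (O₁ + e₂.symm c) = e₁.symm (e₂.symm c) + 1 := by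
      rw [hout _ (by omega)]
      exact he₁ (e₂.symm c)
    have hlt := (e₂.symm c).2
    have hmem' : (execs [.add 0 26 10, .load 1 0, .sub 1 1 20, .add 0 29 1, .load 2 0, .sub 2 2 20,
        .store 11 2, .add 11 11 20, .store 11 1, .add 11 11 20, .store 11 10, .add 11 11 20,
        .add 10 10 20] τ).mem = Function.update (Function.update (Function.update τ.mem
          (2 + 3 * i) (e₁.symm (e₂.symm c))) (2 + 3 * i + 1) (e₂.symm c)) (2 + 3 * i + 2) c := by
      simp [h10, h11, h20, h26, h29, h1, h2, hci, add_assoc]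
    have hout' : ∀ x, x < 2 + 3 * i ∨ 2 + 3 * i + 2 < x → (execs [.add 0 26 10, .load 1 0,
        .sub 1 1 20, .add 0 29 1, .load 2 0, .sub 2 2 20, .store 11 2, .add 11 11 20, .store 11 1,
        .add 11 11 20, .store 11 10, .add 11 11 20, .add 10 10 20] τ).mem x = τ.mem x := by
      intro x hx
      rw [hmem', Function.update_of_ne (by omega), Function.update_of_ne (by omega),
        Function.update_of_ne (by omega)]
    refine ⟨m - 1, by omega, WP.block ?_ ⟨i + 1, by omega, by simp [h20], by simp [h21],
      by simp [h26], by simp [h29], by simp [h10, h20], ?_, ?_, ?_, ?_, ?_⟩⟩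
    · simp [h10, h11, h20, h26, h29, h1, h2]
      omega
    · simp [h11, h20]
      omega
    · rw [hout' _ (by omega), hm0]
    · rw [hout' _ (by omega), hm1]
    · intro d hd
      rcases (Nat.lt_succ_iff.1 hd).lt_or_eq with hd | hd
      · rw [hout' _ (by omega), hout' _ (by omega), hout' _ (by omega)]
        exact hmem d hd
      · obtain rfl : d = c := Fin.ext hd
        rw [hmem', hci]
        simp
    · intro x hx
      rw [hout' _ (by omega), hout x hx]
  · rintro m τ - ⟨i, hm, h20, h21, h26, h29, h10, h11, hm0, hm1, hmem, hout⟩ hc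
    simp only [Test.Holds, h10, h21] at hc
    intro j hj
    have hlen := length_encodeTriples (tripleList e₁ e₂)
    rw [length_tripleList] at hlen
    rw [List.length_cons, hlen] at hj
    rw [← Option.some_inj, ← List.getElem?_eq_getElem]
    obtain rfl | rfl | ⟨q, r, hr, rfl⟩ : j = 0 ∨ j = 1 ∨ ∃ q r, r < 3 ∧ j = 1 + 3 * q + r + 1 := by
      rcases Nat.lt_or_ge j 2 with hj' | hj'
      · omega
      · exact .inr (.inr ⟨(j - 2) / 3, (j - 2) % 3, Nat.mod_lt _ (by norm_num), by omega⟩)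
    · simp [hm0]
    · simp [hm1, encodeTriples, length_tripleList]
    · have hq : q < n := by omega
      rw [List.getElem?_cons_succ,
        getElem?_encodeTriples _ (by rwa [length_tripleList]) hr]
      have hget : (tripleList e₁ e₂)[q]'(by rwa [length_tripleList]) =
          (e₁.symm (e₂.symm ⟨q, hq⟩), e₂.symm ⟨q, hq⟩, ⟨q, hq⟩) := by
        simp [tripleList]
      rw [hget, show 1 + 3 * q + r + 1 = 2 + 3 * q + r by omega]
      obtain ⟨h1, h2, h3⟩ := hmem ⟨q, hq⟩ (by dsimp only; omega)
      dsimp only at h1 h2 h3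
      interval_cases r <;> simp [h1, h2, h3]
  · simp
    omega

/-- The program that finds an `A ∪ B`-popular matching: it solves `(A, B)` and then `(B, C)`, with
separate scratch memory behind the input, and writes `0` if one of them has no solution. -/
def findProg : Prog :=
  .seq sizes (.seq (block [.const 23 2, .add 24 28 28, .add 24 24 28, .add 24 24 23, .add 25 24 22,
      .add 26 25 22])
    (.seq solve (.ite (.lt 27 14)
      (.seq (block [.add 23 23 28, .copy 29 26, .add 24 26 22, .add 25 24 22, .add 26 25 22])
        (.seq solve (.ite (.lt 27 14) output (block [.store 27 27]))))
      (block [.store 27 27]))))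

theorem outputs_single {τ : State} {v : ℕ} (h : τ.mem 0 = v) :
    ∀ i (h : i < [v].length), τ.mem i = [v][i] := by
  intro i hi
  obtain rfl : i = 0 := by simpa using hi
  exact h

/-- The lists of `A` and of `B` begin at the addresses `2` and `n * (n + 1) + 2`, and the two runs
of `solve` use `3 * (n + 1)` words of scratch memory each, from address `3 * (n * (n + 1)) + 2`
on. -/
theorem wp_findProg (hI : I.Complete) (hσ : σ = init I.encode)
    (hW : 100 * (3 * (n * (n + 1)) + 1) ≤ W) :
    WP W findProg (100 * (3 * (n * (n + 1)) + 1)) (fun τ => ∃ output,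
      ((∃ e₁ e₂, I.houseAB.EnvyFirst e₁ ∧ I.houseBC.EnvyFirst e₂ ∧
        output = 1 :: encodeTriples (tripleList e₁ e₂)) ∨
      (¬ ((∃ e₁, I.houseAB.EnvyFirst e₁) ∧ ∃ e₂, I.houseBC.EnvyFirst e₂) ∧ output = [0])) ∧
      ∀ i (h : i < output.length), τ.mem i = output[i]) σ := by
  have hnE : n ≤ n * (n + 1) := Nat.le_mul_of_pos_right n (Nat.succ_pos n)
  have htime : n * (36 * n + 65) ≤ 65 * (n * (n + 1)) := by
    have : n * (36 * n + 65) + 29 * (n * n) = 65 * (n * (n + 1)) := by ring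
    omega
  have hz : ∀ x, 3 * (n * (n + 1)) + 2 ≤ x → σ.mem x = 0 := fun x hx => by
    rw [hσ]
    exact init_mem_eq_zero (by rw [hI.length_encode]; omega)
  have hlA : HoldsLists σ.mem 2 I.houseAB.pref := by
    have := holdsLists_houseAB hI []
    rwa [List.append_nil, ← hσ] at this
  have hlB : HoldsLists σ.mem (n * (n + 1) + 2) I.houseBC.pref := by
    have := holdsLists_houseBC hI []
    rwa [List.append_nil, ← hσ] at this
  refine (WP.seq (k := 4 * n + 5) (l := 7 + ((n * (36 * n + 65) + 13) + ((6 +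
    ((n * (36 * n + 65) + 13) + (15 * n + 6 + 1))) + 1))) (WP.mono (wp_sizes (n := n)
    (fun r => by rw [hσ]; rfl) (by rw [hσ]; rfl) (by omega)) ?_)).le (by omega)
  rintro τ ⟨hmem, h20, h21, h22, h27, h28⟩
  refine WP.block_seq ?_ ?_
  · simp [h22, h28]
    omega
  set τ₁ := execs [.const 23 2, .add 24 28 28, .add 24 24 28, .add 24 24 23, .add 25 24 22,
      .add 26 25 22] τ with hτ₁
  have hS : Setup n 2 (3 * (n * (n + 1)) + 2) τ₁ := by
    constructor <;> simp [hτ₁, h20, h21, h22, h27, h28] <;> omega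
  have h28₁ : τ₁.reg 28 = n * (n + 1) := by simp [hτ₁, h28]
  have hmem₁ : τ₁.mem = σ.mem := by simp [hτ₁, hmem]
  clear_value τ₁
  refine WP.seq (WP.frame 20 rfl (wp_solve (H := I.houseAB) hI.completeA hS (by omega) (by omega)
    (by rwa [hmem₁]) fun x hx _ => by rw [hmem₁, hz x hx]) ?_)
  rintro υ hυ ⟨h, hout⟩
  have hSυ := hS.congr hυ
  rw [hmem₁] at hout
  refine WP.ite ?_ ?_
  · intro hc
    simp only [Test.Holds, hSυ.zero] at hc
    obtain ⟨-, e₁, he₁, hocc₁⟩ := h.resolve_right fun h => by omega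
    have h28υ : υ.reg 28 = n * (n + 1) := (hυ _ (by omega)).trans h28₁
    refine WP.block_seq ?_ ?_
    · simp [h28υ, hSυ.lists, hSυ.arr₃, hSυ.stride]
      omega
    set υ₁ := execs [.add 23 23 28, .copy 29 26, .add 24 26 22, .add 25 24 22, .add 26 25 22] υ
      with hυ₁
    have hS' : Setup n (n * (n + 1) + 2) (3 * (n * (n + 1)) + 2 + 3 * (n + 1)) υ₁ := by
      constructor <;> simp [hυ₁, hSυ.one, hSυ.size, hSυ.stride, hSυ.lists, hSυ.arr₃, hSυ.zero,
        h28υ] <;> omega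
    have h29 : υ₁.reg 29 = 3 * (n * (n + 1)) + 2 + 2 * (n + 1) := by simp [hυ₁, hSυ.arr₃]
    have hmemυ : υ₁.mem = υ.mem := by simp [hυ₁]
    clear_value υ₁
    refine WP.seq (WP.frame 20 rfl (wp_solve (H := I.houseBC) hI.completeB hS' (by omega)
      (by omega) ?_ fun x hx _ => ?_) ?_)
    · refine hlB.congr hI.lengthB fun x hx => ?_
      rw [hmemυ, hout x (by omega)]
    · rw [hmemυ, hout x (by omega), hz x (by omega)]
    rintro ω hω ⟨h', hout'⟩
    have hSω := hS'.congr hω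
    refine WP.ite ?_ ?_
    · intro hc'
      simp only [Test.Holds, hSω.zero] at hc'
      obtain ⟨-, e₂, he₂, hocc₂⟩ := h'.resolve_right fun h => by omega
      refine (WP.mono (wp_output (e₁ := e₁) (e₂ := e₂) hSω.one hSω.size hSω.arr₃ hSω.zero
        ((hω _ (by omega)).trans h29) (by omega) (by omega) (by omega) (by omega) ?_ hocc₂)
        fun κ hκ => ⟨_, .inl ⟨e₁, e₂, he₁, he₂, rfl⟩, hκ⟩)
      exact hocc₁.congr fun x _ _ => by rw [hout' x (by omega), hmemυ]
    · intro hc'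
      simp only [Test.Holds, hSω.zero] at hc'
      have hno := (h'.resolve_left fun h => by omega).2
      exact (WP.block (by simp) ⟨_, .inr ⟨fun h => hno h.2, rfl⟩, outputs_single
        (by simp [hSω.zero])⟩).le (by simp)
  · intro hc
    simp only [Test.Holds, hSυ.zero] at hc
    have hno := (h.resolve_left fun h => by omega).2
    exact (WP.block (by simp) ⟨_, .inr ⟨fun h => hno h.1, rfl⟩, outputs_single
      (by simp [hSυ.zero])⟩).le (by simp; omega)

theorem exists_outputsWithin_findProg (hI : I.Complete) :
    ∃ output, ((∃ e₁ e₂, I.houseAB.EnvyFirst e₁ ∧ I.houseBC.EnvyFirst e₂ ∧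
        output = 1 :: encodeTriples (tripleList e₁ e₂)) ∨
      (¬ ((∃ e₁, I.houseAB.EnvyFirst e₁) ∧ ∃ e₂, I.houseBC.EnvyFirst e₂) ∧ output = [0])) ∧
      OutputsWithin findProg 100 I.encode output := by
  have hlen := hI.length_encode
  have hnE : n ≤ n * (n + 1) := Nat.le_mul_of_pos_right n (Nat.succ_pos n)
  refine WP.outputsWithin (wp_findProg hI rfl (by rw [hlen])) (by rw [hlen]) fun v hv => ?_
  have := hI.le_of_mem_encode hv
  omega

/-- Read the triples from the address in register `11`, and store the houses of the applicants of
both instances. -/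
def readTriples : Prog :=
  .while (.lt 10 21)
    (block [.load 1 11, .add 11 11 20, .load 2 11, .add 11 11 20, .load 3 11, .add 11 11 20,
      .add 0 24 1, .store 0 2, .add 0 29 2, .store 0 3, .add 10 10 20])

theorem wp_readTriples {T S₂ : ℕ} {L : List (Triple n)} (hσ : Setup n a S σ) (h10 : σ.reg 10 = 0)
    (h11 : σ.reg 11 = T) (h29 : σ.reg 29 = S₂) (hT : T + 3 * n ≤ S) (hS : S + n ≤ S₂)
    (hW : S₂ + n ≤ W) (hn : L.length = n)
    (hL : ∀ k (hk : k < L.length), σ.mem (T + 3 * k) = L[k].1 ∧ σ.mem (T + 3 * k + 1) = L[k].2.1 ∧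
      σ.mem (T + 3 * k + 2) = L[k].2.2)
    (hLe : L.toFinset = triples e₁ e₂) :
    WP W readTriples (n * 13 + 1) (fun τ => Holds (n := n) τ.mem S (fun x => e₁ x) ∧
      Holds (n := n) τ.mem S₂ (fun y => e₂ y) ∧
      ∀ x, (x < S ∨ S + n ≤ x) → (x < S₂ ∨ S₂ + n ≤ x) → τ.mem x = σ.mem x) σ := by
  have hmem : ∀ {t}, t ∈ L ↔ e₁ t.1 = t.2.1 ∧ e₂ t.2.1 = t.2.2 := fun {t} => by
    rw [← mem_triples, ← hLe, List.mem_toFinset]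
  refine WP.while (k := 12) 20 rfl (fun m τ => ∃ i, m + i = n ∧ τ.reg 10 = i ∧
    τ.reg 11 = T + 3 * i ∧ (∀ k (hk : k < L.length), k < i → τ.mem (S + L[k].1) = L[k].2.1 ∧
      τ.mem (S₂ + L[k].2.1) = L[k].2.2) ∧
    ∀ x, (x < S ∨ S + n ≤ x) → (x < S₂ ∨ S₂ + n ≤ x) → τ.mem x = σ.mem x) ?_ ?_ ?_
  · exact ⟨0, rfl, h10, h11, fun k _ hk => absurd hk (by omega), fun x _ _ => rfl⟩
  · rintro m τ hτ ⟨i, hm, h10, h11, hread, hout⟩ hc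
    have hS' := hσ.congr hτ
    have h29' : τ.reg 29 = S₂ := (hτ _ (by omega)).trans h29
    simp only [Test.Holds, h10, hS'.size] at hc
    have hi : i < L.length := by omega
    obtain ⟨h1, h2, h3⟩ := hL i hi
    rw [← hout _ (by omega) (by omega)] at h1 h2 h3
    have hlt1 := L[i].1.2
    have hlt2 := L[i].2.1.2
    have hi' := hmem.1 (List.getElem_mem hi)
    have hmem' : (execs [.load 1 11, .add 11 11 20, .load 2 11, .add 11 11 20, .load 3 11,
        .add 11 11 20, .add 0 24 1, .store 0 2, .add 0 29 2, .store 0 3, .add 10 10 20] τ).mem =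
        Function.update (Function.update τ.mem (S + L[i].1) L[i].2.1)
          (S₂ + L[i].2.1) L[i].2.2 := by
      simp [h11, hS'.one, hS'.arr₁, h29', h1, h2, h3]
    refine ⟨m - 1, by omega, WP.block ?_ ⟨i + 1, by omega, by simp [h10, hS'.one], ?_,
      fun k hk hki => ?_, fun x hx hx' => ?_⟩⟩
    · simp [h10, h11, hS'.one, hS'.arr₁, h29', h1, h2]
      omega
    · simp [h11, hS'.one]
      omega
    · have hk1 := L[k].1.2
      have hk' := hmem.1 (List.getElem_mem hk)
      rw [hmem', Function.update_of_ne (by omega), Function.update_apply, Function.update_apply,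
        Function.update_of_ne (by omega)]
      have hold : k ≠ i → τ.mem (S + L[k].1) = L[k].2.1 ∧ τ.mem (S₂ + L[k].2.1) = L[k].2.2 :=
        fun h => hread k hk (by omega)
      refine ⟨?_, ?_⟩
      · split_ifs with h
        · have h' : L[k].1 = L[i].1 := Fin.ext (by omega)
          rw [← hi'.1, ← hk'.1, h']
        · exact (hold (by rintro rfl; exact h rfl)).1
      · split_ifs with h
        · have h' : L[k].2.1 = L[i].2.1 := Fin.ext (by omega)
          rw [← hi'.2, ← hk'.2, h']
        · exact (hold (by rintro rfl; exact h rfl)).2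
    · rw [hmem', Function.update_of_ne (by omega), Function.update_of_ne (by omega),
        hout x hx hx']
  · rintro m τ hτ ⟨i, hm, h10, h11, hread, hout⟩ hc
    have hS' := hσ.congr hτ
    simp only [Test.Holds, h10, hS'.size] at hc
    have key : ∀ x : Fin n, τ.mem (S + x) = e₁ x ∧ τ.mem (S₂ + e₁ x) = e₂ (e₁ x) := fun x => by
      obtain ⟨k, hk, hkx⟩ := List.mem_iff_getElem.1 (hmem.2 ⟨rfl, rfl⟩ :
        (x, e₁ x, e₂ (e₁ x)) ∈ L)
      have := hread k hk (by omega)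
      simpa only [hkx] using this
    refine ⟨fun x => (key x).1, fun y => ?_, hout⟩
    have := (key (e₁.symm y)).2
    rwa [Equiv.apply_symm_apply] at this

/-- The program that decides whether a matching is `A ∪ B`-popular: it must have `n` triples, and
pass the test for `(A, B)` and the one for `(B, C)`. -/
def verifyProg : Prog :=
  .seq sizes (.seq (block [.const 23 2, .add 30 28 28, .add 30 30 28, .add 30 30 20, .load 1 30,
      .add 30 30 20])
    (.ite (.eq 1 21)
      (.seq (block [.add 24 30 22, .add 24 24 22, .add 24 24 22, .add 25 24 22, .add 26 25 22,
          .add 29 26 22, .const 10 0, .copy 11 30])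
        (.seq readTriples (.seq verify (.ite (.lt 27 7)
          (.seq (block [.add 23 23 28, .copy 24 29, .add 25 24 22, .add 26 25 22])
            (.seq verify (block [.store 27 7])))
          (block [.store 27 27])))))
      (block [.store 27 27])))

open Classical in
/-- The number of triples is at address `3 * (n * (n + 1)) + 1`. The arrays for `(A, B)` begin at
address `3 * (n * (n + 1)) + 2 + 3 * (n + 1)`, behind at most `n` triples, and those for `(B, C)`
lie `3 * (n + 1)` words further. -/
theorem wp_verifyProg (hI : I.Complete) {L : List (Triple n)} (hnd : L.Nodup)
    (hL : I.IsMatching L.toFinset) (hσ : σ = init (I.encode ++ encodeTriples L))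
    (hW : 100 * (3 * (n * (n + 1)) + 3 * L.length + 2) ≤ W) :
    WP W verifyProg (100 * (3 * (n * (n + 1)) + 3 * L.length + 2)) (fun τ => ∃ output,
      output = [if I.IsABPopular L.toFinset then 1 else 0] ∧
      ∀ i (h : i < output.length), τ.mem i = output[i]) σ := by
  have hnE : n ≤ n * (n + 1) := Nat.le_mul_of_pos_right n (Nat.succ_pos n)
  have htime : n * (13 * n + 25) ≤ 25 * (n * (n + 1)) := by
    have : n * (13 * n + 25) + 12 * (n * n) = 25 * (n * (n + 1)) := by ring
    omega
  have hz : ∀ x, 3 * (n * (n + 1)) + 3 * L.length + 2 ≤ x → σ.mem x = 0 := fun x hx => by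
    rw [hσ]
    refine init_mem_eq_zero ?_
    rw [List.length_append, hI.length_encode, length_encodeTriples]
    omega
  have hlA : HoldsLists σ.mem 2 I.houseAB.pref := by
    rw [hσ]
    exact holdsLists_houseAB hI _
  have hlB : HoldsLists σ.mem (n * (n + 1) + 2) I.houseBC.pref := by
    rw [hσ]
    exact holdsLists_houseBC hI _
  have hcount : σ.mem (3 * (n * (n + 1)) + 1) = L.length := by
    rw [hσ, ← hI.length_encode]
    exact init_mem_append I.encode (encodeTriples L) 0
  have hentry : ∀ k (hk : k < L.length), ∀ r < 3, σ.mem (3 * (n * (n + 1)) + 2 + 3 * k + r) =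
      [(L[k].1 : ℕ), (L[k].2.1 : ℕ), (L[k].2.2 : ℕ)].getD r 0 := fun k hk r hr => by
    rw [hσ, show 3 * (n * (n + 1)) + 2 + 3 * k + r = I.encode.length + (1 + 3 * k + r) by
      rw [hI.length_encode]; omega, init_mem_append]
    simp only [init, List.getD_eq_getElem?_getD]
    rw [getElem?_encodeTriples L hk hr]
  have htrip : ∀ k (hk : k < L.length), σ.mem (3 * (n * (n + 1)) + 2 + 3 * k) = L[k].1 ∧
      σ.mem (3 * (n * (n + 1)) + 2 + 3 * k + 1) = L[k].2.1 ∧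
      σ.mem (3 * (n * (n + 1)) + 2 + 3 * k + 2) = L[k].2.2 := fun k hk =>
    ⟨hentry k hk 0 (by norm_num), hentry k hk 1 (by norm_num), hentry k hk 2 (by norm_num)⟩
  have hn0 : σ.mem 0 = n := by
    rw [hσ]
    rfl
  -- A popular matching is perfect, so it consists of `n` triples.
  obtain ⟨e₁, e₂, he₁, he₂⟩ := hL.exists_equiv
  have hcard : I.IsABPopular L.toFinset → L.length = n := fun h => by
    rw [← List.toFinset_card_of_nodup hnd, h.eq_triples hI he₁ he₂, card_triples]
  have hLe : L.length = n → L.toFinset = triples e₁ e₂ := fun h =>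
    Finset.eq_of_subset_of_card_le (subset_triples he₁ he₂)
      (by rw [card_triples, List.toFinset_card_of_nodup hnd, h])
  refine (WP.seq (k := 4 * n + 5) (l := 7 + ((9 + ((n * 13 + 1) + ((n * (13 * n + 25) + 9) + ((5 +
    ((n * (13 * n + 25) + 9) + 2)) + 1)))) + 1)) (WP.mono (wp_sizes (n := n)
    (fun r => by rw [hσ]; rfl) hn0 (by omega)) ?_)).le (by omega)
  rintro τ ⟨hmem, h20, h21, h22, h27, h28⟩
  refine WP.block_seq ?_ ?_
  · simp [h20, h28]
    omega
  set τ₁ := execs [.const 23 2, .add 30 28 28, .add 30 30 28, .add 30 30 20, .load 1 30,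
      .add 30 30 20] τ with hτ₁
  have h1 : τ₁.reg 1 = L.length := by
    rw [← hcount, ← hmem]
    simp [hτ₁, h20, h28]
    congr 1
    omega
  have h30 : τ₁.reg 30 = 3 * (n * (n + 1)) + 2 := by
    simp [hτ₁, h20, h28]
    omega
  have h20₁ : τ₁.reg 20 = 1 := by simp [hτ₁, h20]
  have h21₁ : τ₁.reg 21 = n := by simp [hτ₁, h21]
  have h22₁ : τ₁.reg 22 = n + 1 := by simp [hτ₁, h22]
  have h23₁ : τ₁.reg 23 = 2 := by simp [hτ₁]
  have h27₁ : τ₁.reg 27 = 0 := by simp [hτ₁, h27]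
  have h28₁ : τ₁.reg 28 = n * (n + 1) := by simp [hτ₁, h28]
  have hmem₁ : τ₁.mem = σ.mem := by simp [hτ₁, hmem]
  clear_value τ₁
  refine WP.ite ?_ ?_
  swap
  · intro hc
    simp only [Test.Holds, h1, h21₁] at hc
    refine (WP.block (by simp) ⟨_, rfl, outputs_single ?_⟩).le (by simp; omega)
    rw [if_neg fun h => hc (hcard h)]
    simp [h27₁]
  intro hc
  simp only [Test.Holds, h1, h21₁] at hc
  have hpop : I.IsABPopular L.toFinset ↔ I.houseAB.EnvyFirst e₁ ∧ I.houseBC.EnvyFirst e₂ := by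
    rw [hLe hc, isABPopular_triples_iff hI]
  refine WP.block_seq ?_ ?_
  · simp [h22₁, h30]
    omega
  set τ₂ := execs [.add 24 30 22, .add 24 24 22, .add 24 24 22, .add 25 24 22, .add 26 25 22,
          .add 29 26 22, .const 10 0, .copy 11 30] τ₁ with hτ₂
  have hS : Setup n 2 (3 * (n * (n + 1)) + 2 + 3 * (n + 1)) τ₂ := by
    constructor <;> simp [hτ₂, h20₁, h21₁, h22₁, h23₁, h27₁, h30] <;> omega
  have h28₂ : τ₂.reg 28 = n * (n + 1) := by simp [hτ₂, h28₁]
  have h29₂ : τ₂.reg 29 = 3 * (n * (n + 1)) + 2 + 6 * (n + 1) := by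
    simp [hτ₂, h22₁, h30]
    omega
  have h10₂ : τ₂.reg 10 = 0 := by simp [hτ₂]
  have h11₂ : τ₂.reg 11 = 3 * (n * (n + 1)) + 2 := by simp [hτ₂, h30]
  have hmem₂ : τ₂.mem = σ.mem := by simp [hτ₂, hmem₁]
  clear_value τ₂
  refine WP.seq (WP.frame 20 rfl (wp_readTriples (e₁ := e₁) (e₂ := e₂) hS h10₂ h11₂ h29₂ (by omega)
    (by omega) (by omega) hc (by rwa [hmem₂]) (hLe hc)) ?_)
  rintro υ hυ ⟨hA, hB, hout⟩
  have hSυ := hS.congr hυ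
  rw [hmem₂] at hout
  refine WP.seq (WP.frame 20 rfl (wp_verify (H := I.houseAB) (e := e₁) hI.completeA hSυ (by omega)
    (by omega) (hlA.congr hI.lengthA fun x hx => hout x (by omega) (by omega)) hA
    fun x h1 h2 => by rw [hout x (by omega) (by omega), hz x (by omega)]) ?_)
  rintro ω hω ⟨h7, hout'⟩
  have hSω := hSυ.congr hω
  refine WP.ite ?_ ?_
  · intro hc'
    simp only [Test.Holds, hSω.zero, h7] at hc'
    have hgA : I.houseAB.EnvyFirst e₁ := by
      by_contra h
      rw [if_neg h] at hc'
      exact lt_irrefl _ hc'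
    have h28ω : ω.reg 28 = n * (n + 1) :=
      ((hω _ (by omega)).trans (hυ _ (by omega))).trans h28₂
    have h29ω : ω.reg 29 = 3 * (n * (n + 1)) + 2 + 6 * (n + 1) :=
      ((hω _ (by omega)).trans (hυ _ (by omega))).trans h29₂
    refine WP.block_seq ?_ ?_
    · simp [h28ω, h29ω, hSω.lists, hSω.stride]
      omega
    set ω₁ := execs [.add 23 23 28, .copy 24 29, .add 25 24 22, .add 26 25 22] ω with hω₁
    have hS' : Setup n (n * (n + 1) + 2) (3 * (n * (n + 1)) + 2 + 6 * (n + 1)) ω₁ := by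
      constructor <;> simp [hω₁, hSω.one, hSω.size, hSω.stride, hSω.lists, hSω.zero, h28ω,
        h29ω] <;> omega
    have hmemω : ω₁.mem = ω.mem := by simp [hω₁]
    clear_value ω₁
    refine WP.seq (WP.frame 20 rfl (wp_verify (H := I.houseBC) (e := e₂) hI.completeB hS'
      (by omega) (by omega) ?_ ?_ fun x h1 h2 => ?_) ?_)
    · refine hlB.congr hI.lengthB fun x hx => ?_
      rw [hmemω, hout' x (by omega), hout x (by omega) (by omega)]
    · exact hB.congr fun x h1 h2 => by rw [hmemω, hout' x (by omega)]
    · rw [hmemω, hout' x (by omega), hout x (by omega) (by omega), hz x (by omega)]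
    · rintro κ hκ ⟨h7', -⟩
      have hSκ := hS'.congr hκ
      refine WP.block (by simp) ⟨_, rfl, outputs_single ?_⟩
      simp [hSκ.zero, h7', hpop, hgA]
  · intro hc'
    simp only [Test.Holds, hSω.zero, h7] at hc'
    refine (WP.block (by simp) ⟨_, rfl, outputs_single ?_⟩).le (by simp; omega)
    rw [if_neg fun h => hc' (by rw [if_pos (hpop.1 h).1]; exact one_pos)]
    simp [hSω.zero]

open Classical in
theorem outputsWithin_verifyProg (hI : I.Complete) {L : List (Triple n)} (hnd : L.Nodup)
    (hL : I.IsMatching L.toFinset) :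
    OutputsWithin verifyProg 100 (I.encode ++ encodeTriples L)
      [if I.IsABPopular L.toFinset then 1 else 0] := by
  have hlen : (I.encode ++ encodeTriples L).length =
      3 * (n * (n + 1)) + 3 * L.length + 2 := by
    rw [List.length_append, hI.length_encode, length_encodeTriples]
    omega
  have hnE : n ≤ n * (n + 1) := Nat.le_mul_of_pos_right n (Nat.succ_pos n)
  obtain ⟨out, rfl, h⟩ := WP.outputsWithin (wp_verifyProg hI hnd hL rfl (by rw [hlen]))
    (by rw [hlen]) fun v hv => by
      rcases List.mem_append.1 hv with hv | hv
      · have := hI.le_of_mem_encode hv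
        omega
      · have := le_of_mem_encodeTriples hv
        omega
  exact h

end RAM

/-- The three conjuncts: linear-time verification of a matching, which is given by listing its
triples in any order; linear-time computation, with output `0` if there is no `A ∪ B`-popular
matching, and otherwise `1` followed by the triples of one; the decomposition into the house
allocation instances `(A, B)` and `(B, C)`. -/
theorem mainTheorem6 :
    (∃ (p : RAM.Prog) (K : ℕ), ∀ (n : ℕ) (I : CyclicInstance n), I.Complete →
      ∀ L : List (Triple n), L.Nodup → I.IsMatching L.toFinset →
        (I.IsABPopular L.toFinset → RAM.OutputsWithin p K (I.encode ++ encodeTriples L) [1]) ∧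
        (¬ I.IsABPopular L.toFinset → RAM.OutputsWithin p K (I.encode ++ encodeTriples L) [0])) ∧
    (∃ (p : RAM.Prog) (K : ℕ), ∀ (n : ℕ) (I : CyclicInstance n), I.Complete →
      ((∃ M, I.IsABPopular M) →
        ∃ L : List (Triple n), L.Nodup ∧ I.IsABPopular L.toFinset ∧
          RAM.OutputsWithin p K I.encode (1 :: encodeTriples L)) ∧
      ((¬ ∃ M, I.IsABPopular M) → RAM.OutputsWithin p K I.encode [0])) ∧
    (∀ (n : ℕ) (I : CyclicInstance n), I.Complete →
      (∀ M, I.IsMatching M →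
        (I.IsABPopular M ↔
          I.houseAB.IsPopular (CyclicInstance.pairsAB M) ∧
          I.houseBC.IsPopular (CyclicInstance.pairsBC M))) ∧
      ((∃ M, I.IsABPopular M) ↔
        (∃ N, I.houseAB.IsPopular N) ∧ (∃ N, I.houseBC.IsPopular N))) := by
  refine ⟨⟨RAM.verifyProg, 100, fun n I hI L hnd hL => ?_⟩, ⟨RAM.findProg, 100, fun n I hI => ?_⟩,
    fun n I hI => ⟨fun M hM => CyclicInstance.isABPopular_iff hI hM,
      CyclicInstance.exists_isABPopular_iff hI⟩⟩
  · have h := RAM.outputsWithin_verifyProg hI hnd hL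
    exact ⟨fun hp => by rwa [if_pos hp] at h, fun hp => by rwa [if_neg hp] at h⟩
  · have hiff : (∃ M, I.IsABPopular M) ↔
        (∃ e₁, I.houseAB.EnvyFirst e₁) ∧ ∃ e₂, I.houseBC.EnvyFirst e₂ := by
      rw [CyclicInstance.exists_isABPopular_iff hI,
        HouseAllocation.exists_isPopular_iff hI.completeA rfl,
        HouseAllocation.exists_isPopular_iff hI.completeB rfl]
    obtain ⟨out, ⟨e₁, e₂, he₁, he₂, rfl⟩ | ⟨hno, rfl⟩, h⟩ := RAM.exists_outputsWithin_findProg hI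
    · refine ⟨fun _ => ⟨RAM.tripleList e₁ e₂, RAM.nodup_tripleList, ?_, h⟩,
        fun hp => absurd (hiff.2 ⟨⟨e₁, he₁⟩, e₂, he₂⟩) hp⟩
      rw [RAM.toFinset_tripleList]
      exact (CyclicInstance.isABPopular_triples_iff hI).2 ⟨he₁, he₂⟩
    · exact ⟨fun hp => absurd (hiff.1 hp) hno, fun _ => h⟩
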